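/- **Setting.** Let $L>0$ and let $\epsilon,\mu:\mathbb R^2\to\mathbb R$ be measurable functions of $(x,z)$, bounded below and above by positive constants, $2\pi$-periodic in $x$, even in $z$, and equal to constants $\epsilon_0,\mu_0$ for $|z|\ge L$. Let $\Omega=(-\pi,\pi)\times(-L,L)$, let $\Gamma$ be its two sides $z=\pm L$, and let $H=\{u\in H^1(\Omega): u(\pi,\cdot)=u(-\pi,\cdot)\}$ (traces). For complex $(\kappa,\omega)$ put $\boldsymbol\kappa=(\kappa,0)$ and $\eta_m=\sqrt{\epsilon_0\mu_0\omega^2-(m+\kappa)^2}$ (branch cut on the negative imaginary axis, $\sqrt{s}>0$ for $s>0$), and let $N$ be the operator on functions on $\Gamma$ that multiplies the $m$-th Fourier coefficient in $x$ on each side by $-i\eta_m$. On $H$ define $$h(u,v)=\int_\Omega\mu^{-1}(\nabla+i\boldsymbol\kappa)u\cdot(\nabla-i\boldsymbol\kappa)\bar v+\mu_0^{-1}\!\int_\Gamma (Nu)\bar v,\qquad \beta(u,v)=\int_\Omega\epsilon\,u\bar v ,$$ let $C_1,C_2$ be the bounded operators representing the forms $h+\beta$ and $-(\omega^2+1)\beta$,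 and let $A(\kappa,\omega)=I+C_1^{-1}C_2$ (the identity plus a compact operator). Let $(\kappa_0,\omega_0)$ lie in the region of one propagating harmonic $$\mathcal D=\{(\kappa,\omega)\in\mathbb R^2:\ |\kappa|<\tfrac12,\ |\kappa|<\omega\sqrt{\epsilon_0\mu_0}<1-|\kappa|\}.$$ Suppose that for all $(\kappa,\omega)$ in a complex neighbourhood of $(\kappa_0,\omega_0)$ the spectrum of $A(\kappa,\omega)$ in a fixed disk about $0$ consists of one algebraically simple eigenvalue $\tilde\ell(\kappa,\omega)$. Let $\ell=c\tilde\ell$ with a constant $c\neq0$, and suppose $\ell(\kappa_0,\omega_0)=0$. For real $(\kappa,\omega)$ near $(\kappa_0,\omega_0)$ let $a=\ell R$ and $b=\ell T$, where $R$ and $T$ are the reflection and transmission coefficients for the incident field $u^{\rm inc}=e^{i\eta_0z}$: if $u\in H$ solves $$h(u,v)-\omega^2\beta(u,v)=\mu_0^{-1}\!\int_\Gamma(\partial_nu^{\rm inc}+Nu^{\rm inc})\bar v\quad\text{for all }v\in H,$$ then the zeroth Fourier coefficients of $u$ on $z=-L$ and on $z=L$ are $e^{-i\eta_0L}+Re^{i\eta_0L}$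 and $Te^{i\eta_0L}$, respectively. Write $\hat\kappa=\kappa-\kappa_0$, $\hat\omega=\omega-\omega_0$. Assume the generic conditions $$\frac{\partial\ell}{\partial\omega}\ne0,\qquad \frac{\partial a}{\partial\omega}\ne0,\qquad \frac{\partial b}{\partial\omega}\ne0\qquad\text{at }(\kappa_0,\omega_0),$$ and let $r_n,t_n,\ell_n\in\mathbb C$ be the coefficients in the Weierstrass factorizations near $(\kappa_0,\omega_0)$, $$a=(\hat\omega+r_1\hat\kappa+r_2\hat\kappa^2+\cdots)\,G_a,\qquad b=(\hat\omega+t_1\hat\kappa+t_2\hat\kappa^2+\cdots)\,G_b,\qquad \ell=(\hat\omega+\ell_1\hat\kappa+\ell_2\hat\kappa^2+\cdots)\,G_\ell,$$ where the power series in $\hat\kappa$ converge near $0$ and $G_a,G_b,G_\ell$ are analytic at $(\kappa_0,\omega_0)$. **Lemma 3.2.** If $\operatorname{Im}\ell_2>0$, then exactly one of the following holds: (i) $r_2$ and $t_2$ are distinct real numbers; (ii) $r_2=t_2\notin\mathbb R$, and either $\ell_2=r_2=t_2$ or $\ell_2=\bar r_2=\bar t_2$. -/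

import Mathlib

open MeasureTheory Filter Topology
open scoped ComplexConjugate InnerProductSpace

noncomputable section

namespace PeriodicSlab

/-- A two-dimensional lossless periodic dielectric slab, symmetric about the line `z = 0`.
Points of the plane are pairs `(x, z)`; `ep`, `mu` are the material coefficients and `ep0`, `mu0`
their constant values in the ambient medium `|z| ≥ L`. -/
structure Slab where
  ep : ℝ × ℝ → ℝ
  mu : ℝ × ℝ → ℝ
  L : ℝ
  ep0 : ℝ
  mu0 : ℝ
  L_pos : 0 < L
  ep_meas : Measurable ep
  mu_meas : Measurable mu
  ep_periodic : ∀ x z, ep (x + 2 * Real.pi, z) = ep (x, z)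
  mu_periodic : ∀ x z, mu (x + 2 * Real.pi, z) = mu (x, z)
  ep_outside : ∀ x z, L ≤ |z| → ep (x, z) = ep0
  mu_outside : ∀ x z, L ≤ |z| → mu (x, z) = mu0
  ep_bounds : ∃ lo hi : ℝ, 0 < lo ∧ ∀ p, lo < ep p ∧ ep p < hi
  mu_bounds : ∃ lo hi : ℝ, 0 < lo ∧ ∀ p, lo < mu p ∧ mu p < hi
  ep_symm : ∀ x z, ep (x, -z) = ep (x, z)
  mu_symm : ∀ x z, mu (x, -z) = mu (x, z)

/-! ### The periodic Sobolev space on one truncated period -/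

/-- The truncated period `(-π, π) × (-L, L)`. -/
def cell (L : ℝ) : Set (ℝ × ℝ) :=
  Set.Ioo (-Real.pi) Real.pi ×ˢ Set.Ioo (-L) L

/-- Lebesgue measure on the truncated period. -/
abbrev cellMeasure (L : ℝ) : Measure (ℝ × ℝ) := volume.restrict (cell L)

instance cellMeasure_finite (L : ℝ) : IsFiniteMeasure (cellMeasure L) := by
  refine ⟨?_⟩
  rw [Measure.restrict_apply_univ, cell, Measure.volume_eq_prod, Measure.prod_prod]
  exact ENNReal.mul_lt_top (by simp) (by simp)

/-- Triples of square-integrable functions on the truncated period, with the Hilbert norm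
`(‖u₀‖² + ‖u₁‖² + ‖u₂‖²)^{1/2}`. -/
abbrev L2Triple (L : ℝ) : Type :=
  PiLp 2 (fun _ : Fin 3 => Lp ℂ 2 (cellMeasure L))

/-- Test functions: smooth in the plane, `2π`-periodic in `x`, and vanishing near `|z| ≥ L`. -/
structure IsTest (L : ℝ) (f : ℝ × ℝ → ℂ) : Prop where
  smooth : ContDiff ℝ (⊤ : ℕ∞) f
  periodic : ∀ x z, f (x + 2 * Real.pi, z) = f (x, z)
  support : ∃ r < L, ∀ x z, r ≤ |z| → f (x, z) = 0

/-- `(u, ux, uz)` consists of a function and its weak partial derivatives, the equations being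
tested against all functions that are smooth and `2π`-periodic in `x` and vanish near `z = ± L`.
Testing across the sides `x = ± π` expresses that the traces of `u` at `x = π` and `x = -π`
agree. -/
def IsWeakGradient (L : ℝ) (U : L2Triple L) : Prop :=
  ∀ f : ℝ × ℝ → ℂ, IsTest L f →
    (∫ p, U 0 p * fderiv ℝ f p (1, 0) ∂cellMeasure L = -∫ p, U 1 p * f p ∂cellMeasure L) ∧
    (∫ p, U 0 p * fderiv ℝ f p (0, 1) ∂cellMeasure L = -∫ p, U 2 p * f p ∂cellMeasure L)

theorem integrable_mul_of_continuous {L : ℝ} (u : Lp ℂ 2 (cellMeasure L)) {g : ℝ × ℝ → ℂ}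
    (hg : Continuous g) : Integrable (fun p => u p * g p) (cellMeasure L) := by
  have hu : Integrable (fun p => u p) (cellMeasure L) :=
    (Lp.memLp u).integrable (by norm_num)
  obtain ⟨C, hC⟩ := ((isCompact_Icc (a := -Real.pi) (b := Real.pi)).prod
    (isCompact_Icc (a := -L) (b := L))).exists_bound_of_continuousOn hg.continuousOn
  refine hu.mul_bdd (c := C) hg.aestronglyMeasurable ?_
  refine (ae_restrict_iff' (measurableSet_Ioo.prod measurableSet_Ioo)).2 (ae_of_all _ ?_)
  intro p hp
  exact hC p ⟨Set.Ioo_subset_Icc_self hp.1, Set.Ioo_subset_Icc_self hp.2⟩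

theorem IsTest.continuous_fderiv_apply {L : ℝ} {f : ℝ × ℝ → ℂ} (hf : IsTest L f) (e : ℝ × ℝ) :
    Continuous (fun p => fderiv ℝ f p e) :=
  (hf.smooth.continuous_fderiv (by simp)).clm_apply continuous_const

theorem integral_add_mul {L : ℝ} (u v : Lp ℂ 2 (cellMeasure L)) {g : ℝ × ℝ → ℂ}
    (hg : Continuous g) :
    ∫ p, (u + v : Lp ℂ 2 (cellMeasure L)) p * g p ∂cellMeasure L
      = ∫ p, u p * g p ∂cellMeasure L + ∫ p, v p * g p ∂cellMeasure L := by
  rw [← integral_add (integrable_mul_of_continuous u hg) (integrable_mul_of_continuous v hg)]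
  refine integral_congr_ae ?_
  filter_upwards [Lp.coeFn_add u v] with p hp
  rw [hp, Pi.add_apply, add_mul]

theorem integral_smul_mul {L : ℝ} (c : ℂ) (u : Lp ℂ 2 (cellMeasure L)) (g : ℝ × ℝ → ℂ) :
    ∫ p, (c • u : Lp ℂ 2 (cellMeasure L)) p * g p ∂cellMeasure L
      = c * ∫ p, u p * g p ∂cellMeasure L := by
  rw [← integral_const_mul]
  refine integral_congr_ae ?_
  filter_upwards [Lp.coeFn_smul c u] with p hp
  rw [hp, Pi.smul_apply, smul_eq_mul, mul_assoc]

theorem integral_zero_mul {L : ℝ} (g : ℝ × ℝ → ℂ) :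
    ∫ p, (0 : Lp ℂ 2 (cellMeasure L)) p * g p ∂cellMeasure L = 0 := by
  have h := integral_smul_mul (0 : ℂ) (0 : Lp ℂ 2 (cellMeasure L)) g
  rwa [zero_smul, zero_mul] at h

/-- The periodic Sobolev space `H¹_per` of the truncated period, realised as the space of triples
`(u, ∂ₓu, ∂_z u)`; the inherited inner product is that of `H¹`. -/
def H1per (L : ℝ) : Submodule ℂ (L2Triple L) where
  carrier := {U | IsWeakGradient L U}
  add_mem' := by
    intro U V hU hV f hf
    have h0 := hf.smooth.continuous
    have h1 := hf.continuous_fderiv_apply (1, 0)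
    have h2 := hf.continuous_fderiv_apply (0, 1)
    simp only [PiLp.add_apply]
    rw [integral_add_mul _ _ h1, integral_add_mul _ _ h2, integral_add_mul _ _ h0,
      integral_add_mul _ _ h0, (hU f hf).1, (hV f hf).1, (hU f hf).2, (hV f hf).2]
    constructor <;> ring
  zero_mem' := by
    intro f hf
    simp only [PiLp.zero_apply]
    rw [integral_zero_mul, integral_zero_mul, integral_zero_mul]
    simp
  smul_mem' := by
    intro c U hU f hf
    simp only [PiLp.smul_apply]
    rw [integral_smul_mul, integral_smul_mul, integral_smul_mul, integral_smul_mul,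
      (hU f hf).1, (hU f hf).2]
    constructor <;> ring

/-- The value `u`. -/
def val {L : ℝ} (u : H1per L) : ℝ × ℝ → ℂ := fun p => u.1 0 p
/-- The weak derivative `∂ₓ u`. -/
def dx {L : ℝ} (u : H1per L) : ℝ × ℝ → ℂ := fun p => u.1 1 p
/-- The weak derivative `∂_z u`. -/
def dz {L : ℝ} (u : H1per L) : ℝ × ℝ → ℂ := fun p => u.1 2 p

/-- The exponential `e^{-imx}`. -/
def harmonic (m : ℤ) (p : ℝ × ℝ) : ℂ := Complex.exp (-(Complex.I * m * p.1))

/-- The Fourier coefficient `û_m⁺` of the trace of `u` on `z = L`, so that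
`u(x, L) = ∑ û_m⁺ e^{imx}`.  The trace is expressed through the divergence theorem with the weight
`χ(z) = (z + L) / (2L)`, which is `1` at `z = L` and `0` at `z = -L`:
`∫ u(x, L) e^{-imx} dx = ∫∫ (∂_z u χ + u χ') e^{-imx} dx dz`. -/
def traceTop {L : ℝ} (u : H1per L) (m : ℤ) : ℂ :=
  (2 * Real.pi : ℂ)⁻¹ * ∫ p, (dz u p * (((p.2 + L) / (2 * L) : ℝ) : ℂ)
    + val u p * ((1 / (2 * L) : ℝ) : ℂ)) * harmonic m p ∂cellMeasure L

/-- The Fourier coefficient `û_m⁻` of the trace of `u` on `z = -L`; here the weight is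
`χ(z) = (L - z) / (2L)`, and `∫ u(x, -L) e^{-imx} dx = -∫∫ (∂_z u χ + u χ') e^{-imx} dx dz`. -/
def traceBot {L : ℝ} (u : H1per L) (m : ℤ) : ℂ :=
  -((2 * Real.pi : ℂ)⁻¹ * ∫ p, (dz u p * (((L - p.2) / (2 * L) : ℝ) : ℂ)
    + val u p * ((-1 / (2 * L) : ℝ) : ℂ)) * harmonic m p ∂cellMeasure L)

/-! ### The scattering problem -/

/-- The square root with branch cut on the negative imaginary axis, equal to `√s` for `s > 0` and
to `i √|s|` for `s < 0`. -/
def branchSqrt (s : ℂ) : ℂ :=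
  Complex.exp (Complex.I * Real.pi / 4) * (-Complex.I * s) ^ (1 / 2 : ℂ)

namespace Slab

variable (S : Slab)

/-- The real pairs `(κ, ω)` with exactly one propagating harmonic (the diamond `𝒟`). -/
def diamond : Set (ℝ × ℝ) :=
  {q | |q.1| < 1 / 2 ∧ |q.1| < q.2 * √(S.ep0 * S.mu0) ∧ q.2 * √(S.ep0 * S.mu0) < 1 - |q.1|}

/-- The exponents `η_m`, with `η_m² = ε₀ μ₀ ω² - (m + κ)²`. -/
def eta (m : ℤ) (κ ω : ℂ) : ℂ :=
  branchSqrt (S.ep0 * S.mu0 * ω ^ 2 - (m + κ) ^ 2)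

/-- `∫_Γ (N u) v̄`, where `N` is the Dirichlet-to-Neumann map, which multiplies the `m`-th Fourier
coefficient on each of the two components `z = ± L` of `Γ` by `-i η_m`. -/
def dtnForm (κ ω : ℂ) (u v : H1per S.L) : ℂ :=
  2 * Real.pi * ∑' m : ℤ, -Complex.I * S.eta m κ ω *
    (traceTop u m * conj (traceTop v m) + traceBot u m * conj (traceBot v m))

/-- `h(u, v) = ∫_Ω μ⁻¹ (∇ + iκ)u · (∇ - iκ)v̄ + μ₀⁻¹ ∫_Γ (N u) v̄`, with `κ` in the direction
`x`. -/
def formH (κ ω : ℂ) (u v : H1per S.L) : ℂ :=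
  (∫ p, ((S.mu p)⁻¹ : ℂ) *
      ((dx u p + Complex.I * κ * val u p) * (conj (dx v p) - Complex.I * κ * conj (val v p))
        + dz u p * conj (dz v p)) ∂cellMeasure S.L)
    + (S.mu0 : ℂ)⁻¹ * S.dtnForm κ ω u v

/-- `b(u, v) = ∫_Ω ε u v̄`. -/
def formB (u v : H1per S.L) : ℂ :=
  ∫ p, (S.ep p : ℂ) * (val u p * conj (val v p)) ∂cellMeasure S.L

/-- `c₁ = h + b`. -/
def formC1 (κ ω : ℂ) (u v : H1per S.L) : ℂ := S.formH κ ω u v + S.formB u v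

/-- `c₂ = -(ω² + 1) b`. -/
def formC2 (ω : ℂ) (u v : H1per S.L) : ℂ := -(ω ^ 2 + 1) * S.formB u v

/-- `C` represents the form `c`: `(C u, v) = c(u, v)`, with the inner product linear in its first
slot (Mathlib's is linear in the second). -/
def Represents (c : H1per S.L → H1per S.L → ℂ) (C : H1per S.L →L[ℂ] H1per S.L) : Prop :=
  ∀ u v, ⟪v, C u⟫_ℂ = c u v

open Classical in
/-- The bounded operator that represents a bounded form (unique when it exists). -/
def formOp (c : H1per S.L → H1per S.L → ℂ) : H1per S.L →L[ℂ] H1per S.L :=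
  if h : ∃ C, S.Represents c C then h.choose else 0

/-- The operator `A(κ, ω) = I + C₁(κ, ω)⁻¹ C₂(κ, ω)`. -/
def opA (κ ω : ℂ) : H1per S.L →L[ℂ] H1per S.L :=
  1 + Ring.inverse (S.formOp (S.formC1 κ ω)) * S.formOp (S.formC2 ω)

/-- The periodic factor `A₀ e^{iη₀z} + B₀ e^{-iη₀z}` of the incident field. -/
def incident (A₀ B₀ κ ω : ℂ) (z : ℝ) : ℂ :=
  A₀ * Complex.exp (Complex.I * S.eta 0 κ ω * z)
    + B₀ * Complex.exp (-(Complex.I * S.eta 0 κ ω * z))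

/-- The `z`-derivative of the incident field. -/
def incidentDeriv (A₀ B₀ κ ω : ℂ) (z : ℝ) : ℂ :=
  Complex.I * S.eta 0 κ ω * (A₀ * Complex.exp (Complex.I * S.eta 0 κ ω * z)
    - B₀ * Complex.exp (-(Complex.I * S.eta 0 κ ω * z)))

/-- `p(v) = μ₀⁻¹ ∫_Γ (∂_n uⁱⁿᶜ + N uⁱⁿᶜ) v̄`; only the harmonic `m = 0` contributes. -/
def sourceP (A₀ B₀ κ ω : ℂ) (v : H1per S.L) : ℂ :=
  (S.mu0 : ℂ)⁻¹ * (2 * Real.pi *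
    ((S.incidentDeriv A₀ B₀ κ ω S.L - Complex.I * S.eta 0 κ ω * S.incident A₀ B₀ κ ω S.L)
        * conj (traceTop v 0)
      + (-S.incidentDeriv A₀ B₀ κ ω (-S.L) - Complex.I * S.eta 0 κ ω
            * S.incident A₀ B₀ κ ω (-S.L)) * conj (traceBot v 0)))

/-- `u` solves the scattering problem in variational form. -/
def IsScattering (A₀ B₀ κ ω : ℂ) (u : H1per S.L) : Prop :=
  ∀ v, S.formH κ ω u v - ω ^ 2 * S.formB u v = S.sourceP A₀ B₀ κ ω v

/-- A solution of the scattering problem with the field `e^{i(κx + η₀z)}` incident from the left.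
All solutions have the same propagating harmonics when `(κ, ω)` lies in the diamond. -/
def scattered (κ ω : ℂ) : H1per S.L := Classical.epsilon (S.IsScattering 1 0 κ ω)

/-- The reflection coefficient `R`: the zeroth harmonic on `z = -L` is
`e^{-iη₀L} + R e^{iη₀L}`. -/
def reflection (κ ω : ℂ) : ℂ :=
  (traceBot (S.scattered κ ω) 0 - Complex.exp (-(Complex.I * S.eta 0 κ ω * S.L)))
    * Complex.exp (-(Complex.I * S.eta 0 κ ω * S.L))

/-- The transmission coefficient `T`: the zeroth harmonic on `z = L` is `T e^{iη₀L}`. -/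
def transmission (κ ω : ℂ) : ℂ :=
  traceTop (S.scattered κ ω) 0 * Complex.exp (-(Complex.I * S.eta 0 κ ω * S.L))

/-- `a = ℓ R` at real pairs. -/
def coeffA (ell : ℂ × ℂ → ℂ) (q : ℝ × ℝ) : ℂ := ell (q.1, q.2) * S.reflection q.1 q.2

/-- `b = ℓ T` at real pairs. -/
def coeffB (ell : ℂ × ℂ → ℂ) (q : ℝ × ℝ) : ℂ := ell (q.1, q.2) * S.transmission q.1 q.2

/-- For all complex `(κ, ω)` near the real pair `q₀`, the number `lam (κ, ω)` is the only point of
the spectrum of `A(κ, ω)` in a fixed disk about `0`, and it is an (algebraically) simple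
eigenvalue. -/
def IsSimpleEigenvalueNear (lam : ℂ × ℂ → ℂ) (q₀ : ℝ × ℝ) : Prop :=
  ∃ δ > 0, ∀ᶠ q : ℂ × ℂ in 𝓝 ((q₀.1 : ℂ), (q₀.2 : ℂ)),
    spectrum ℂ (S.opA q.1 q.2) ∩ Metric.ball 0 δ = {lam q} ∧
    Module.End.HasEigenvalue (S.opA q.1 q.2 : Module.End ℂ (H1per S.L)) (lam q) ∧
    Module.finrank ℂ
      (Module.End.maxGenEigenspace (S.opA q.1 q.2 : Module.End ℂ (H1per S.L)) (lam q)) = 1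

end Slab

/-! ### Factorized expansions -/

/-- `F(κ, ω) = (ω̂ + f(κ̂)) G(κ, ω)` at all complex `(κ, ω)` near the real pair `q₀`, where
`κ̂ = κ - κ₀`, `ω̂ = ω - ω₀`, the function `f` is analytic at `0` with `f(0) = 0`, and `G` is
analytic at `q₀`. -/
def Factors (F : ℂ × ℂ → ℂ) (q₀ : ℝ × ℝ) (f : ℂ → ℂ) (G : ℂ × ℂ → ℂ) : Prop :=
  AnalyticAt ℂ f 0 ∧ f 0 = 0 ∧ AnalyticAt ℂ G ((q₀.1 : ℂ), (q₀.2 : ℂ)) ∧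
    ∀ᶠ q : ℂ × ℂ in 𝓝 ((q₀.1 : ℂ), (q₀.2 : ℂ)), F q = (q.2 - q₀.2 + f (q.1 - q₀.1)) * G q

/-- The same factorization for a function of real pairs, required at all real `(κ, ω)` near
`q₀`. -/
def FactorsReal (F : ℝ × ℝ → ℂ) (q₀ : ℝ × ℝ) (f : ℂ → ℂ) (G : ℂ × ℂ → ℂ) : Prop :=
  AnalyticAt ℂ f 0 ∧ f 0 = 0 ∧ AnalyticAt ℂ G ((q₀.1 : ℂ), (q₀.2 : ℂ)) ∧
    ∀ᶠ q : ℝ × ℝ in 𝓝 q₀,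
      F q = ((q.2 : ℂ) - q₀.2 + f ((q.1 : ℂ) - q₀.1)) * G ((q.1 : ℂ), (q.2 : ℂ))

/-- The `n`-th Taylor coefficient of `f` at `0`. -/
def taylorCoeff (f : ℂ → ℂ) (n : ℕ) : ℂ := iteratedDeriv n f 0 / (n.factorial : ℂ)

end PeriodicSlab

end

/-!
At real `(κ, ω)` the coefficients `a = ℓ R`, `b = ℓ T` and `ℓ` satisfy `|a|² + |b|² = |ℓ|²` and
`Re (a b̄) = 0`.  The first identity is conservation of energy, the second comes from the mirror
symmetry of the slab; both are imaginary parts of the variational equation for the scattered field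
`u`, tested against `u` and against its mirror image (`Slab.scattering_relations`).  Only the
propagating harmonic contributes to the imaginary part of the Dirichlet-to-Neumann form, once its
series is known to converge, and this is the trace theorem `H¹ → H^{1/2}` (`summable_traceTop`).
The scattered field exists wherever `ℓ ≠ 0`: close to `(κ₀, ω₀)` the eigenvalue is not `1`, so
`A(κ, ω)` is not the identity, which forces the forms to be represented by bounded operators and
`C₁` to be invertible (`Slab.represents_of_opA_ne_one`).

For fixed real `κ` the two identities extend to complex `ω`, with complex conjugates replaced by
holomorphic functions (`slice_identities`).  Let `f_a`, `f_b`, `f_ℓ` be the series in the factors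
`ω̂ + f(κ̂)`.  Evaluating the second identity at the zero `ω̂ = -f_a` of `a` and at the zero
`ω̂ = -f_b` of `b` shows that at every real `κ̂` either `f_a = f_b` or both are real; by analyticity
one alternative holds throughout.  If `f_a = f_b`, the first identity at `ω̂ = -f_a` gives `f_ℓ = f_a`
or `f_ℓ = f̄_a`, which is the second alternative of the theorem.  If both are real, the linear
coefficient of `f_ℓ` is real as well, since a source-free field cannot exist at real `κ` and `Im ω > 0`
(`Slab.zeros_im_nonpos`).  The first identity at the two zeros then forces the three linear
coefficients to agree, and, if the quadratic coefficients of `f_a` and `f_b` agreed too, it would force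
the quadratic coefficient of `f_ℓ` to be equal to them, hence real, against `Im ℓ₂ > 0`
(`taylorCoeff_dichotomy`).
-/

noncomputable section

namespace PeriodicSlab

/-! ### Factorized functions of a real pair -/

theorem tendsto_ofReal_punctured :
    Tendsto (fun x : ℝ => (x : ℂ)) (𝓝[≠] 0) (𝓝[≠] 0) := by
  refine tendsto_nhdsWithin_iff.2 ⟨?_, ?_⟩
  · have h : Tendsto (fun x : ℝ => (x : ℂ)) (𝓝 0) (𝓝 0) := by
      simpa using Complex.continuous_ofReal.tendsto 0
    exact h.mono_left nhdsWithin_le_nhds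
  · filter_upwards [self_mem_nhdsWithin] with x hx
    simpa using hx

theorem tendsto_ofReal_zero : Tendsto (fun x : ℝ => (x : ℂ)) (𝓝 0) (𝓝 0) := by
  simpa using Complex.continuous_ofReal.tendsto 0

/-- Identity principle in the second variable: a family `Φ x` holomorphic on a fixed disk that
vanishes at real pairs near the origin vanishes along every path `y = g(x)` into the origin. -/
theorem slice_eq_zero {Φ : ℝ → ℂ → ℂ} {r : ℝ} (hr : 0 < r)
    (hd : ∀ᶠ x in 𝓝 0, DifferentiableOn ℂ (Φ x) (Metric.ball 0 r))
    (hz : ∀ᶠ q : ℝ × ℝ in 𝓝 (0, 0), Φ q.1 (q.2 : ℂ) = 0)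
    {g : ℝ → ℂ} (hg : Tendsto g (𝓝 0) (𝓝 0)) : ∀ᶠ x in 𝓝 0, Φ x (g x) = 0 := by
  rw [nhds_prod_eq] at hz
  filter_upwards [hd, hz.curry, hg (Metric.ball_mem_nhds 0 hr)] with x hdx hzx hgx
  have hfreq : ∃ᶠ z in 𝓝[≠] (0 : ℂ), Φ x z = 0 := by
    refine tendsto_ofReal_punctured.frequently ?_
    exact (hzx.filter_mono nhdsWithin_le_nhds).frequently
  exact (hdx.analyticOnNhd Metric.isOpen_ball).eqOn_zero_of_preconnected_of_frequently_eq_zero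
    (convex_ball 0 r).isPreconnected (Metric.mem_ball_self hr) hfreq hgx

/-- `G(x, ·)` and its conjugate `conj (G(x, conj ·))` are holomorphic on a disk whose radius does not
depend on the small real number `x`. -/
theorem exists_slice_differentiableOn {G : ℂ × ℂ → ℂ} (hG : AnalyticAt ℂ G (0, 0)) :
    ∃ r > 0, ∀ᶠ x : ℝ in 𝓝 0,
      DifferentiableOn ℂ (fun y => G ((x : ℂ), y)) (Metric.ball 0 r) ∧
      DifferentiableOn ℂ (fun y => conj (G ((x : ℂ), conj y))) (Metric.ball 0 r) := by
  obtain ⟨r, hr, hball⟩ := Metric.eventually_nhds_iff_ball.1 hG.eventually_analyticAt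
  refine ⟨r, hr, ?_⟩
  filter_upwards [tendsto_ofReal_zero (Metric.ball_mem_nhds 0 hr)] with x hx
  have key : ∀ y ∈ Metric.ball (0 : ℂ) r, DifferentiableAt ℂ (fun y => G ((x : ℂ), y)) y := by
    intro y hy
    have h1 : DifferentiableAt ℂ G ((x : ℂ), y) := by
      refine (hball _ ?_).differentiableAt
      rw [← ball_prod_same]
      exact ⟨hx, hy⟩
    exact h1.comp y (by fun_prop)
  refine ⟨fun y hy => (key y hy).differentiableWithinAt, fun y hy => ?_⟩
  have h2 := (key (conj y) (by simpa using hy)).conj_conj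
  rw [Complex.conj_conj] at h2
  exact h2.differentiableWithinAt

theorem tendsto_slice {G : ℂ × ℂ → ℂ} (hG : AnalyticAt ℂ G (0, 0)) {g : ℝ → ℂ}
    (hg : Tendsto g (𝓝 0) (𝓝 0)) :
    Tendsto (fun x : ℝ => G ((x : ℂ), g x)) (𝓝 0) (𝓝 (G (0, 0))) :=
  hG.continuousAt.tendsto.comp (tendsto_ofReal_zero.prodMk_nhds hg)

theorem tendsto_real {f : ℂ → ℂ} (hf : AnalyticAt ℂ f 0) (h0 : f 0 = 0) :
    Tendsto (fun x : ℝ => f x) (𝓝 0) (𝓝 0) := by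
  have := hf.continuousAt.tendsto.comp tendsto_ofReal_zero
  rwa [h0] at this

theorem tendsto_div_taylorCoeff_one {f : ℂ → ℂ} (hf : AnalyticAt ℂ f 0) (h0 : f 0 = 0) :
    Tendsto (fun x : ℝ => f x / x) (𝓝[≠] 0) (𝓝 (taylorCoeff f 1)) := by
  have h := (hasDerivAt_iff_tendsto_slope.1 hf.differentiableAt.hasDerivAt).comp
    tendsto_ofReal_punctured
  have e : taylorCoeff f 1 = deriv f 0 := by simp [taylorCoeff]
  rw [e]
  refine h.congr fun x => ?_
  simp [slope_def_field, h0]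

theorem tendsto_div_taylorCoeff_two {f : ℂ → ℂ} (hf : AnalyticAt ℂ f 0) (h0 : f 0 = 0) :
    Tendsto (fun x : ℝ => (f x - taylorCoeff f 1 * x) / (x : ℂ) ^ 2) (𝓝[≠] 0)
      (𝓝 (taylorCoeff f 2)) := by
  have h := hf.hasFPowerSeriesAt.isBigO_sub_partialSum_pow 3
  have h2 : Tendsto (fun z : ℂ => (f z - taylorCoeff f 1 * z - taylorCoeff f 2 * z ^ 2) / z ^ 2)
      (𝓝[≠] 0) (𝓝 0) := by
    have h3 : (fun z : ℂ => f z - taylorCoeff f 1 * z - taylorCoeff f 2 * z ^ 2)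
        =O[𝓝 0] fun z => z ^ 3 := by
      refine (h.congr_left fun z => ?_).trans (Asymptotics.isBigO_of_le _ fun z => by simp)
      simp [FormalMultilinearSeries.partialSum, Finset.sum_range_succ, taylorCoeff, h0]
      ring
    have h4 : (fun z : ℂ => z ^ 3) =o[𝓝 0] fun z : ℂ => z ^ 2 :=
      Asymptotics.isLittleO_pow_pow (by norm_num)
    exact ((h3.trans_isLittleO h4).mono nhdsWithin_le_nhds).tendsto_div_nhds_zero
  have h5 := (h2.comp tendsto_ofReal_punctured).add_const (taylorCoeff f 2)
  rw [zero_add] at h5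
  refine h5.congr' ?_
  filter_upwards [self_mem_nhdsWithin] with x hx
  have hx' : (x : ℂ) ≠ 0 := by simpa using hx
  simp only [Function.comp]
  field_simp
  ring

/-- Taylor coefficients are determined by values at real points. -/
theorem taylorCoeff_eq_conj {f g : ℂ → ℂ} (hf : AnalyticAt ℂ f 0) (f0 : f 0 = 0)
    (hg : AnalyticAt ℂ g 0) (g0 : g 0 = 0) (h : ∀ᶠ x : ℝ in 𝓝[≠] 0, f x = conj (g x)) :
    taylorCoeff f 1 = conj (taylorCoeff g 1) ∧ taylorCoeff f 2 = conj (taylorCoeff g 2) := by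
  have c1 : taylorCoeff f 1 = conj (taylorCoeff g 1) := by
    refine tendsto_nhds_unique (tendsto_div_taylorCoeff_one hf f0) ?_
    refine ((Complex.continuous_conj.tendsto _).comp
      (tendsto_div_taylorCoeff_one hg g0)).congr' ?_
    filter_upwards [h] with x hx
    simp [hx]
  refine ⟨c1, ?_⟩
  refine tendsto_nhds_unique (tendsto_div_taylorCoeff_two hf f0) ?_
  refine ((Complex.continuous_conj.tendsto _).comp
    (tendsto_div_taylorCoeff_two hg g0)).congr' ?_
  filter_upwards [h] with x hx
  simp [hx, c1]

/-- Two functions analytic at `0` agree near `0` or differ at all real points of a punctured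
neighbourhood. -/
theorem eventually_eq_or_ne {f g : ℂ → ℂ} (hf : AnalyticAt ℂ f 0) (hg : AnalyticAt ℂ g 0) :
    f =ᶠ[𝓝 0] g ∨ ∀ᶠ x : ℝ in 𝓝[≠] 0, f x ≠ g x := by
  rcases (hf.sub hg).eventually_eq_zero_or_eventually_ne_zero with h | h
  · left
    filter_upwards [h] with z hz
    exact sub_eq_zero.1 hz
  · right
    filter_upwards [tendsto_ofReal_punctured.eventually h] with x hx hfg
    exact hx (by simp [hfg])

/-- A function analytic at `0` with nonnegative imaginary part at real points has a real
derivative, since the sign of its linear part changes at `0`. -/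
theorem taylorCoeff_one_im_eq_zero {f : ℂ → ℂ} (hf : AnalyticAt ℂ f 0) (f0 : f 0 = 0)
    (h : ∀ᶠ x : ℝ in 𝓝 0, 0 ≤ (f x).im) : (taylorCoeff f 1).im = 0 := by
  have h1 : Tendsto (fun x : ℝ => (f x).im / x) (𝓝[≠] 0) (𝓝 (taylorCoeff f 1).im) := by
    refine ((Complex.continuous_im.tendsto _).comp
      (tendsto_div_taylorCoeff_one hf f0)).congr fun x => ?_
    simp [Complex.div_ofReal_im]
  refine le_antisymm ?_ ?_
  · refine le_of_tendsto (h1.mono_left (nhdsLT_le_nhdsNE 0)) ?_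
    filter_upwards [self_mem_nhdsWithin, h.filter_mono nhdsWithin_le_nhds] with x hx hfx
    exact div_nonpos_of_nonneg_of_nonpos hfx (le_of_lt hx)
  · refine ge_of_tendsto (h1.mono_left (nhdsGT_le_nhdsNE 0)) ?_
    filter_upwards [self_mem_nhdsWithin, h.filter_mono nhdsWithin_le_nhds] with x hx hfx
    exact div_nonneg hfx (le_of_lt hx)

/-- The factorized function `(y + f(x)) G(x, y)` at a real first and a complex second argument. -/
def slice (f : ℂ → ℂ) (G : ℂ × ℂ → ℂ) (x : ℝ) (y : ℂ) : ℂ := (y + f x) * G ((x : ℂ), y)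

/-- The function holomorphic in `y` that agrees with the complex conjugate of `slice f G x y` at
real `y`. -/
def sliceConj (f : ℂ → ℂ) (G : ℂ × ℂ → ℂ) (x : ℝ) (y : ℂ) : ℂ :=
  (y + conj (f x)) * conj (G ((x : ℂ), conj y))

theorem sliceConj_ofReal (f : ℂ → ℂ) (G : ℂ × ℂ → ℂ) (x y : ℝ) :
    sliceConj f G x y = conj (slice f G x y) := by
  simp [sliceConj, slice]

theorem eventually_slice_differentiableOn (f : ℂ → ℂ) {G : ℂ × ℂ → ℂ} {r : ℝ}
    (h : ∀ᶠ x : ℝ in 𝓝 0,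
      DifferentiableOn ℂ (fun y => G ((x : ℂ), y)) (Metric.ball 0 r) ∧
      DifferentiableOn ℂ (fun y => conj (G ((x : ℂ), conj y))) (Metric.ball 0 r)) :
    ∀ᶠ x : ℝ in 𝓝 0, DifferentiableOn ℂ (slice f G x) (Metric.ball 0 r) ∧
      DifferentiableOn ℂ (sliceConj f G x) (Metric.ball 0 r) := by
  filter_upwards [h] with x hx
  exact ⟨(differentiableOn_id.add_const _).mul hx.1, (differentiableOn_id.add_const _).mul hx.2⟩

/-- The relations between three factorized functions of a real pair that express conservation of
energy and the mirror symmetry, extended to complex values of the second variable. -/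
theorem slice_identities {fa fb fl : ℂ → ℂ} {Ga Gb Gl : ℂ × ℂ → ℂ}
    (hGa : AnalyticAt ℂ Ga (0, 0)) (hGb : AnalyticAt ℂ Gb (0, 0)) (hGl : AnalyticAt ℂ Gl (0, 0))
    (henergy : ∀ᶠ q : ℝ × ℝ in 𝓝 (0, 0), Complex.normSq (slice fa Ga q.1 q.2)
      + Complex.normSq (slice fb Gb q.1 q.2) = Complex.normSq (slice fl Gl q.1 q.2))
    (hsymm : ∀ᶠ q : ℝ × ℝ in 𝓝 (0, 0),
      (slice fa Ga q.1 q.2 * conj (slice fb Gb q.1 q.2)).re = 0)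
    {g : ℝ → ℂ} (hg : Tendsto g (𝓝 0) (𝓝 0)) :
    (∀ᶠ x in 𝓝 0, slice fa Ga x (g x) * sliceConj fa Ga x (g x)
      + slice fb Gb x (g x) * sliceConj fb Gb x (g x)
      = slice fl Gl x (g x) * sliceConj fl Gl x (g x)) ∧
    (∀ᶠ x in 𝓝 0, slice fa Ga x (g x) * sliceConj fb Gb x (g x)
      + sliceConj fa Ga x (g x) * slice fb Gb x (g x) = 0) := by
  obtain ⟨ra, hra, ha⟩ := exists_slice_differentiableOn hGa
  obtain ⟨rb, hrb, hb⟩ := exists_slice_differentiableOn hGb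
  obtain ⟨rl, hrl, hl⟩ := exists_slice_differentiableOn hGl
  have ha' := eventually_slice_differentiableOn fa ha
  have hb' := eventually_slice_differentiableOn fb hb
  have hl' := eventually_slice_differentiableOn fl hl
  set r := min ra (min rb rl) with hr
  have sa : Metric.ball (0 : ℂ) r ⊆ Metric.ball 0 ra := Metric.ball_subset_ball (min_le_left _ _)
  have sb : Metric.ball (0 : ℂ) r ⊆ Metric.ball 0 rb :=
    Metric.ball_subset_ball ((min_le_right _ _).trans (min_le_left _ _))
  have sl : Metric.ball (0 : ℂ) r ⊆ Metric.ball 0 rl :=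
    Metric.ball_subset_ball ((min_le_right _ _).trans (min_le_right _ _))
  have hr0 : 0 < r := lt_min hra (lt_min hrb hrl)
  constructor
  · have := slice_eq_zero (Φ := fun x y => slice fa Ga x y * sliceConj fa Ga x y
      + slice fb Gb x y * sliceConj fb Gb x y - slice fl Gl x y * sliceConj fl Gl x y) hr0 ?_ ?_ hg
    · filter_upwards [this] with x hx
      exact sub_eq_zero.1 hx
    · filter_upwards [ha', hb', hl'] with x hxa hxb hxl
      exact (((hxa.1.mono sa).mul (hxa.2.mono sa)).add ((hxb.1.mono sb).mul (hxb.2.mono sb))).sub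
        ((hxl.1.mono sl).mul (hxl.2.mono sl))
    · filter_upwards [henergy] with q hq
      simp only [sliceConj_ofReal, Complex.mul_conj]
      rw [← hq]
      push_cast
      ring
  · refine slice_eq_zero (Φ := fun x y => slice fa Ga x y * sliceConj fb Gb x y
      + sliceConj fa Ga x y * slice fb Gb x y) hr0 ?_ ?_ hg
    · filter_upwards [ha', hb'] with x hxa hxb
      exact ((hxa.1.mono sa).mul (hxb.2.mono sb)).add ((hxa.2.mono sa).mul (hxb.1.mono sb))
    · filter_upwards [hsymm] with q hq
      simp only [sliceConj_ofReal]
      have := Complex.add_conj (slice fa Ga q.1 q.2 * conj (slice fb Gb q.1 q.2))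
      rw [hq] at this
      simpa using this

theorem eventually_factor_ne_zero {G : ℂ × ℂ → ℂ} (hG : AnalyticAt ℂ G (0, 0))
    (h0 : G (0, 0) ≠ 0) {g : ℝ → ℂ} (hg : Tendsto g (𝓝 0) (𝓝 0)) :
    ∀ᶠ x : ℝ in 𝓝 0, G ((x : ℂ), g x) ≠ 0 ∧ G ((x : ℂ), conj (g x)) ≠ 0 := by
  have hg' : Tendsto (fun x => conj (g x)) (𝓝 0) (𝓝 0) := by
    have h := (Complex.continuous_conj.tendsto 0).comp hg
    rwa [map_zero] at h
  exact ((tendsto_slice hG hg).eventually_ne h0).and ((tendsto_slice hG hg').eventually_ne h0)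

/-- The relation between the leading factors at the origin. -/
theorem normSq_factor_add {fa fb fl : ℂ → ℂ} {Ga Gb Gl : ℂ × ℂ → ℂ}
    (hGa : AnalyticAt ℂ Ga (0, 0)) (hGb : AnalyticAt ℂ Gb (0, 0)) (hGl : AnalyticAt ℂ Gl (0, 0))
    (a0 : fa 0 = 0) (b0 : fb 0 = 0) (l0 : fl 0 = 0)
    (henergy : ∀ᶠ q : ℝ × ℝ in 𝓝 (0, 0), Complex.normSq (slice fa Ga q.1 q.2)
      + Complex.normSq (slice fb Gb q.1 q.2) = Complex.normSq (slice fl Gl q.1 q.2)) :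
    Complex.normSq (Ga (0, 0)) + Complex.normSq (Gb (0, 0)) = Complex.normSq (Gl (0, 0)) := by
  have hy : Tendsto (fun y : ℝ => ((0 : ℝ), y)) (𝓝[≠] 0) (𝓝 (0, 0)) :=
    (tendsto_const_nhds.prodMk_nhds tendsto_id).mono_left nhdsWithin_le_nhds
  have lim : ∀ {G : ℂ × ℂ → ℂ}, AnalyticAt ℂ G (0, 0) →
      Tendsto (fun y : ℝ => Complex.normSq (G (0, (y : ℂ)))) (𝓝[≠] 0)
        (𝓝 (Complex.normSq (G (0, 0)))) := by
    intro G hG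
    have h1 : Tendsto (fun y : ℝ => ((0 : ℂ), (y : ℂ))) (𝓝[≠] 0) (𝓝 (0, 0)) :=
      (tendsto_const_nhds.prodMk_nhds tendsto_ofReal_zero).mono_left nhdsWithin_le_nhds
    exact (Complex.continuous_normSq.tendsto _).comp (hG.continuousAt.tendsto.comp h1)
  refine tendsto_nhds_unique (((lim hGa).add (lim hGb)).congr' ?_) (lim hGl)
  filter_upwards [hy.eventually henergy, self_mem_nhdsWithin] with y hq hy0
  have hy1 : y * y ≠ 0 := mul_self_ne_zero.2 hy0
  simp only [slice, Complex.ofReal_zero, a0, b0, l0, add_zero, map_mul,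
    Complex.normSq_ofReal] at hq
  rw [← mul_add] at hq
  exact mul_left_cancel₀ hy1 hq

/-- The dichotomy for the quadratic coefficients of three factorized functions whose restrictions
to real pairs satisfy the energy and symmetry relations, when the zeros of the third function are
stable. -/
theorem taylorCoeff_dichotomy {fa fb fl : ℂ → ℂ} {Ga Gb Gl : ℂ × ℂ → ℂ}
    (ha : AnalyticAt ℂ fa 0) (hb : AnalyticAt ℂ fb 0) (hl : AnalyticAt ℂ fl 0)
    (a0 : fa 0 = 0) (b0 : fb 0 = 0) (l0 : fl 0 = 0)
    (hGa : AnalyticAt ℂ Ga (0, 0)) (hGb : AnalyticAt ℂ Gb (0, 0)) (hGl : AnalyticAt ℂ Gl (0, 0))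
    (Ga0 : Ga (0, 0) ≠ 0) (Gb0 : Gb (0, 0) ≠ 0) (Gl0 : Gl (0, 0) ≠ 0)
    (henergy : ∀ᶠ q : ℝ × ℝ in 𝓝 (0, 0), Complex.normSq (slice fa Ga q.1 q.2)
      + Complex.normSq (slice fb Gb q.1 q.2) = Complex.normSq (slice fl Gl q.1 q.2))
    (hsymm : ∀ᶠ q : ℝ × ℝ in 𝓝 (0, 0),
      (slice fa Ga q.1 q.2 * conj (slice fb Gb q.1 q.2)).re = 0)
    (hstable : ∀ᶠ x : ℝ in 𝓝 0, 0 ≤ (fl x).im) (him : 0 < (taylorCoeff fl 2).im) :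
    ((taylorCoeff fa 2).im = 0 ∧ (taylorCoeff fb 2).im = 0 ∧ taylorCoeff fa 2 ≠ taylorCoeff fb 2) ∨
      (taylorCoeff fa 2 = taylorCoeff fb 2 ∧ (taylorCoeff fa 2).im ≠ 0 ∧
        (taylorCoeff fl 2 = taylorCoeff fa 2 ∨ taylorCoeff fl 2 = conj (taylorCoeff fa 2))) := by
  have tneg : ∀ {f : ℂ → ℂ}, AnalyticAt ℂ f 0 → f 0 = 0 →
      Tendsto (fun x : ℝ => -f x) (𝓝 0) (𝓝 0) := by
    intro f hf f0
    simpa using (tendsto_real hf f0).neg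
  have ta := tneg ha a0
  have tb := tneg hb b0
  obtain ⟨Ea, Sa⟩ := slice_identities hGa hGb hGl henergy hsymm ta
  obtain ⟨Eb, Sb⟩ := slice_identities hGa hGb hGl henergy hsymm tb
  rcases eventually_eq_or_ne ha hb with hab | hab
  · -- The zero sets of the first two functions coincide, and `fl` is `fa` or its conjugate.
    right
    have c2 : taylorCoeff fa 2 = taylorCoeff fb 2 := by
      simp [taylorCoeff, hab.iteratedDeriv_eq]
    have hlin : taylorCoeff fl 2 = taylorCoeff fa 2
        ∨ taylorCoeff fl 2 = conj (taylorCoeff fa 2) := by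
      rcases eventually_eq_or_ne hl ha with hla | hla
      · left
        simp [taylorCoeff, hla.iteratedDeriv_eq]
      · right
        refine (taylorCoeff_eq_conj hl l0 ha a0 ?_).2
        have nl := eventually_factor_ne_zero hGl Gl0 ta
        filter_upwards [hla, Ea.filter_mono nhdsWithin_le_nhds,
          nl.filter_mono nhdsWithin_le_nhds,
          (tendsto_ofReal_zero.eventually hab).filter_mono nhdsWithin_le_nhds] with x h1 h2 h3 h4
        have e : slice fl Gl x (-fa x) * sliceConj fl Gl x (-fa x) = 0 := by
          rw [← h2]
          simp [slice, ← h4]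
        rcases mul_eq_zero.1 e with e | e
        · rcases mul_eq_zero.1 e with e | e
          · exact absurd (by linear_combination e) h1
          · exact absurd e h3.1
        · rcases mul_eq_zero.1 e with e | e
          · have : conj (fl x) = fa x := by linear_combination e
            rw [← this, Complex.conj_conj]
          · exact absurd ((map_eq_zero _).1 e) h3.2
    refine ⟨c2, ?_, hlin⟩
    rcases hlin with h | h
    · rw [← h]; exact him.ne'
    · rw [h, Complex.conj_im] at him
      intro h'
      rw [h'] at him
      simp at him
  · -- Off the origin the zero sets differ, which forces both to be real.
    left
    have na := eventually_factor_ne_zero hGa Ga0 tb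
    have nb := eventually_factor_ne_zero hGb Gb0 ta
    have na' := eventually_factor_ne_zero hGa Ga0 ta
    have nb' := eventually_factor_ne_zero hGb Gb0 tb
    have reala : ∀ᶠ x : ℝ in 𝓝[≠] 0, fa x = conj (fa x) := by
      filter_upwards [hab, Sa.filter_mono nhdsWithin_le_nhds, nb.filter_mono nhdsWithin_le_nhds,
        na'.filter_mono nhdsWithin_le_nhds] with x h1 h2 h3 h4
      simp only [slice, sliceConj, neg_add_cancel, zero_mul, zero_add, mul_eq_zero, map_eq_zero]
        at h2
      rcases h2 with (h2 | h2) | (h2 | h2)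
      · linear_combination -h2
      · exact absurd h2 h4.2
      · exact absurd (by linear_combination -h2) h1
      · exact absurd h2 h3.1
    have realb : ∀ᶠ x : ℝ in 𝓝[≠] 0, fb x = conj (fb x) := by
      filter_upwards [hab, Sb.filter_mono nhdsWithin_le_nhds, na.filter_mono nhdsWithin_le_nhds,
        nb'.filter_mono nhdsWithin_le_nhds] with x h1 h2 h3 h4
      simp only [slice, sliceConj, neg_add_cancel, zero_mul, mul_zero, add_zero, mul_eq_zero,
        map_eq_zero] at h2
      rcases h2 with (h2 | h2) | (h2 | h2)
      · exact absurd (by linear_combination h2) h1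
      · exact absurd h2 h3.1
      · linear_combination -h2
      · exact absurd h2 h4.2
    obtain ⟨a1, a2⟩ := taylorCoeff_eq_conj ha a0 ha a0 reala
    obtain ⟨b1, b2⟩ := taylorCoeff_eq_conj hb b0 hb b0 realb
    refine ⟨Complex.conj_eq_iff_im.1 a2.symm, Complex.conj_eq_iff_im.1 b2.symm, fun hab2 => ?_⟩
    have l1 : conj (taylorCoeff fl 1) = taylorCoeff fl 1 :=
      Complex.conj_eq_iff_im.2 (taylorCoeff_one_im_eq_zero hl l0 hstable)
    have hsum := normSq_factor_add hGa hGb hGl a0 b0 l0 henergy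
    -- The energy relation on the zero sets of the first and the second function.
    have Ra : ∀ᶠ x : ℝ in 𝓝[≠] 0, (fb x - fa x) * conj (fb x - fa x)
        * (Gb ((x : ℂ), -fa x) * conj (Gb ((x : ℂ), -fa x)))
        = (fl x - fa x) * conj (fl x - fa x)
        * (Gl ((x : ℂ), -fa x) * conj (Gl ((x : ℂ), -fa x))) := by
      filter_upwards [Ea.filter_mono nhdsWithin_le_nhds, reala] with x h1 h2
      simp only [slice, sliceConj, map_neg, map_sub, ← h2] at h1 ⊢
      linear_combination h1
    have Rb : ∀ᶠ x : ℝ in 𝓝[≠] 0, (fb x - fa x) * conj (fb x - fa x)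
        * (Ga ((x : ℂ), -fb x) * conj (Ga ((x : ℂ), -fb x)))
        = (fl x - fb x) * conj (fl x - fb x)
        * (Gl ((x : ℂ), -fb x) * conj (Gl ((x : ℂ), -fb x))) := by
      filter_upwards [Eb.filter_mono nhdsWithin_le_nhds, realb] with x h1 h2
      simp only [slice, sliceConj, map_neg, map_sub, ← h2] at h1 ⊢
      linear_combination h1
    have nsq : ∀ {u : ℝ → ℂ} {c : ℂ}, Tendsto u (𝓝[≠] 0) (𝓝 c) →
        Tendsto (fun x => u x * conj (u x)) (𝓝[≠] 0) (𝓝 (c * conj c)) := fun hu =>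
      hu.mul ((Complex.continuous_conj.tendsto _).comp hu)
    have wk : ∀ {u : ℝ → ℂ} {c : ℂ}, Tendsto u (𝓝 0) (𝓝 c) → Tendsto u (𝓝[≠] 0) (𝓝 c) :=
      fun hu => hu.mono_left nhdsWithin_le_nhds
    have d1 : ∀ {f g : ℂ → ℂ}, AnalyticAt ℂ f 0 → f 0 = 0 → AnalyticAt ℂ g 0 → g 0 = 0 →
        Tendsto (fun x : ℝ => (f x - g x) / x) (𝓝[≠] 0)
          (𝓝 (taylorCoeff f 1 - taylorCoeff g 1)) := by
      intro f g hf f0 hg g0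
      refine ((tendsto_div_taylorCoeff_one hf f0).sub
        (tendsto_div_taylorCoeff_one hg g0)).congr fun x => ?_
      ring
    have d2 : ∀ {f g : ℂ → ℂ}, AnalyticAt ℂ f 0 → f 0 = 0 → AnalyticAt ℂ g 0 → g 0 = 0 →
        taylorCoeff f 1 = taylorCoeff g 1 →
        Tendsto (fun x : ℝ => (f x - g x) / (x : ℂ) ^ 2) (𝓝[≠] 0)
          (𝓝 (taylorCoeff f 2 - taylorCoeff g 2)) := by
      intro f g hf f0 hg g0 h
      refine ((tendsto_div_taylorCoeff_two hf f0).sub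
        (tendsto_div_taylorCoeff_two hg g0)).congr fun x => ?_
      rw [h]
      ring
    set A := Complex.normSq (Ga (0, 0)) with hA
    set B := Complex.normSq (Gb (0, 0)) with hB
    set C := Complex.normSq (Gl (0, 0)) with hC
    have hApos : 0 < A := Complex.normSq_pos.2 Ga0
    have hBpos : 0 < B := Complex.normSq_pos.2 Gb0
    have hCpos : 0 < C := Complex.normSq_pos.2 Gl0
    -- First order: the linear coefficients agree.
    have Fa := tendsto_nhds_unique_of_eventuallyEq
      ((nsq (d1 hb b0 ha a0)).mul (nsq (wk (tendsto_slice hGb ta))))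
      ((nsq (d1 hl l0 ha a0)).mul (nsq (wk (tendsto_slice hGl ta)))) (by
        filter_upwards [Ra] with x hx
        simp only [map_div₀, Complex.conj_ofReal]
        linear_combination ((x : ℂ)⁻¹) ^ 2 * hx)
    have Fb := tendsto_nhds_unique_of_eventuallyEq
      ((nsq (d1 hb b0 ha a0)).mul (nsq (wk (tendsto_slice hGa tb))))
      ((nsq (d1 hl l0 hb b0)).mul (nsq (wk (tendsto_slice hGl tb)))) (by
        filter_upwards [Rb] with x hx
        simp only [map_div₀, Complex.conj_ofReal]
        linear_combination ((x : ℂ)⁻¹) ^ 2 * hx)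
    simp only [Complex.mul_conj, ← Complex.ofReal_mul, Complex.ofReal_inj, ← hA, ← hB, ← hC]
      at Fa Fb
    obtain ⟨α, hα⟩ : ∃ α : ℝ, taylorCoeff fa 1 = α := ⟨_, (Complex.conj_eq_iff_re.1 a1.symm).symm⟩
    obtain ⟨β, hβ⟩ : ∃ β : ℝ, taylorCoeff fb 1 = β := ⟨_, (Complex.conj_eq_iff_re.1 b1.symm).symm⟩
    obtain ⟨γ, hγ⟩ : ∃ γ : ℝ, taylorCoeff fl 1 = γ := ⟨_, (Complex.conj_eq_iff_re.1 l1).symm⟩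
    rw [hα, hβ, hγ] at Fa
    rw [hα, hβ, hγ] at Fb
    simp only [← Complex.ofReal_sub, Complex.normSq_ofReal] at Fa Fb
    -- As `C = A + B`, the sum of the relations is `(γ - α)² + (γ - β)² = (β - α)²`.
    have e1 : (γ - α) * (γ - β) = 0 := by
      have : C * ((γ - α) * (γ - β)) = 0 := by
        rw [← hsum] at Fa Fb ⊢
        nlinarith
      rcases mul_eq_zero.1 this with h | h
      · exact absurd h hCpos.ne'
      · exact h
    have e2 : β = α ∧ γ = α := by
      rcases mul_eq_zero.1 e1 with h | h
      · rw [h] at Fa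
        have h' : (β - α) * (β - α) = 0 := by
          rcases mul_eq_zero.1 (Fa.trans (by ring) : (β - α) * (β - α) * B = 0) with h | h
          · exact h
          · exact absurd h hBpos.ne'
        have := mul_self_eq_zero.1 h'
        constructor <;> linarith
      · rw [h] at Fb
        have h' : (β - α) * (β - α) = 0 := by
          rcases mul_eq_zero.1 (Fb.trans (by ring) : (β - α) * (β - α) * A = 0) with h | h
          · exact h
          · exact absurd h hApos.ne'
        have := mul_self_eq_zero.1 h'
        constructor <;> linarith
    -- Second order: `fl` would have the real second coefficient of `fa`.
    have F2 := tendsto_nhds_unique_of_eventuallyEq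
      ((nsq (d2 hb b0 ha a0 (by rw [hα, hβ, e2.1]))).mul (nsq (wk (tendsto_slice hGb ta))))
      ((nsq (d2 hl l0 ha a0 (by rw [hα, hγ, e2.2]))).mul (nsq (wk (tendsto_slice hGl ta)))) (by
        filter_upwards [Ra] with x hx
        simp only [map_div₀, map_pow, Complex.conj_ofReal]
        linear_combination ((x : ℂ)⁻¹) ^ 4 * hx)
    rw [← hab2, sub_self, zero_mul, zero_mul, Complex.mul_conj, Complex.mul_conj, eq_comm] at F2
    have h3 : taylorCoeff fl 2 - taylorCoeff fa 2 = 0 := by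
      rcases mul_eq_zero.1 F2 with h | h
      · exact Complex.normSq_eq_zero.1 (Complex.ofReal_eq_zero.1 h)
      · exact absurd (Complex.ofReal_eq_zero.1 h) hCpos.ne'
    rw [sub_eq_zero.1 h3, Complex.conj_eq_iff_im.1 a2.symm] at him
    exact lt_irrefl _ him

/-! ### Integration by parts on the truncated period -/

theorem measurableSet_cell (L : ℝ) : MeasurableSet (cell L) :=
  measurableSet_Ioo.prod measurableSet_Ioo

theorem exists_bound_cell {L : ℝ} {g : ℝ × ℝ → ℂ} (hg : Continuous g) :
    ∃ C, ∀ p ∈ cell L, ‖g p‖ ≤ C := by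
  obtain ⟨C, hC⟩ := ((isCompact_Icc (a := -Real.pi) (b := Real.pi)).prod
    (isCompact_Icc (a := -L) (b := L))).exists_bound_of_continuousOn hg.continuousOn
  exact ⟨C, fun p hp => hC p ⟨Set.Ioo_subset_Icc_self hp.1, Set.Ioo_subset_Icc_self hp.2⟩⟩

theorem memLp_of_continuous {L : ℝ} {g : ℝ × ℝ → ℂ} (hg : Continuous g) :
    MemLp g 2 (cellMeasure L) := by
  obtain ⟨C, hC⟩ := exists_bound_cell (L := L) hg
  exact MemLp.of_bound hg.aestronglyMeasurable C
    ((ae_restrict_iff' (measurableSet_cell L)).2 (ae_of_all _ hC))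

/-- A continuous function as an element of `L²` of the truncated period. -/
def toL2 (L : ℝ) {g : ℝ × ℝ → ℂ} (hg : Continuous g) : Lp ℂ 2 (cellMeasure L) :=
  (memLp_of_continuous hg).toLp g

theorem toL2_coeFn (L : ℝ) {g : ℝ × ℝ → ℂ} (hg : Continuous g) :
    toL2 L hg =ᵐ[cellMeasure L] g := (memLp_of_continuous hg).coeFn_toLp

theorem inner_toL2 {L : ℝ} {g : ℝ × ℝ → ℂ} (hg : Continuous g) (w : Lp ℂ 2 (cellMeasure L)) :
    ⟪toL2 L hg, w⟫_ℂ = ∫ p, w p * conj (g p) ∂cellMeasure L := by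
  rw [L2.inner_def]
  refine integral_congr_ae ?_
  filter_upwards [toL2_coeFn L hg] with p hp
  rw [hp]
  rfl

theorem exists_bound_deriv_smoothTransition :
    ∃ D, 0 ≤ D ∧ ∀ t, |deriv Real.smoothTransition t| ≤ D := by
  have hc : Continuous (deriv Real.smoothTransition) :=
    (Real.smoothTransition.contDiff (n := 1)).continuous_deriv le_rfl
  obtain ⟨D, hD⟩ := (isCompact_Icc (a := (0 : ℝ)) (b := 1)).exists_bound_of_continuousOn
    hc.continuousOn
  have hD0 : 0 ≤ D := (norm_nonneg _).trans (hD 0 (by simp))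
  refine ⟨D, hD0, fun t => ?_⟩
  rcases lt_or_ge t 0 with h | h
  · have e : Real.smoothTransition =ᶠ[𝓝 t] fun _ => 0 := by
      filter_upwards [Iio_mem_nhds h] with s hs
      exact Real.smoothTransition.zero_of_nonpos (le_of_lt hs)
    rw [e.deriv_eq]
    simpa using hD0
  · rcases lt_or_ge 1 t with h1 | h1
    · have e : Real.smoothTransition =ᶠ[𝓝 t] fun _ => 1 := by
        filter_upwards [Ioi_mem_nhds h1] with s hs
        exact Real.smoothTransition.one_of_one_le (le_of_lt hs)
      rw [e.deriv_eq]
      simpa using hD0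
    · exact hD t ⟨h, h1⟩

theorem deriv_smoothTransition_of_one_lt {t : ℝ} (h : 1 < t) :
    deriv Real.smoothTransition t = 0 := by
  have e : Real.smoothTransition =ᶠ[𝓝 t] fun _ => 1 := by
    filter_upwards [Ioi_mem_nhds h] with s hs
    exact Real.smoothTransition.one_of_one_le (le_of_lt hs)
  rw [e.deriv_eq]
  simp

/-- A smooth cutoff in `z` that vanishes within `1 / N` of `z = ± L` and is `1` at distance
more than `2 / N` from there. -/
def cutoff (L N z : ℝ) : ℝ :=
  Real.smoothTransition (N * (L - z) - 1) * Real.smoothTransition (N * (L + z) - 1)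

/-- The derivative of `cutoff` in `z`. -/
def cutoffDeriv (L N z : ℝ) : ℝ :=
  -N * deriv Real.smoothTransition (N * (L - z) - 1) * Real.smoothTransition (N * (L + z) - 1)
    + Real.smoothTransition (N * (L - z) - 1) *
      (N * deriv Real.smoothTransition (N * (L + z) - 1))

theorem hasDerivAt_cutoff (L N z : ℝ) : HasDerivAt (cutoff L N) (cutoffDeriv L N z) z := by
  have hs : ∀ t, HasDerivAt Real.smoothTransition (deriv Real.smoothTransition t) t := fun t =>
    ((Real.smoothTransition.contDiff (n := 1)).differentiable (by simp) t).hasDerivAt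
  have h1 : HasDerivAt (fun z => N * (L - z) - 1) (-N) z := by
    simpa using (((hasDerivAt_id z).const_sub L).const_mul N).sub_const 1
  have h2 : HasDerivAt (fun z => N * (L + z) - 1) N z := by
    simpa using (((hasDerivAt_id z).const_add L).const_mul N).sub_const 1
  have := ((hs _).comp z h1).mul ((hs _).comp z h2)
  refine this.congr_deriv ?_
  simp only [cutoffDeriv, Function.comp]
  ring

theorem contDiff_cutoff (L N : ℝ) : ContDiff ℝ (⊤ : ℕ∞) (cutoff L N) := by
  unfold cutoff
  exact (Real.smoothTransition.contDiff.comp (by fun_prop)).mul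
    (Real.smoothTransition.contDiff.comp (by fun_prop))

theorem abs_cutoff_le_one (L N z : ℝ) : |cutoff L N z| ≤ 1 := by
  rw [cutoff, abs_mul, abs_of_nonneg (Real.smoothTransition.nonneg _),
    abs_of_nonneg (Real.smoothTransition.nonneg _)]
  exact mul_le_one₀ (Real.smoothTransition.le_one _) (Real.smoothTransition.nonneg _)
    (Real.smoothTransition.le_one _)

/-- At every interior height the cutoff is eventually `1`, with derivative `0`. -/
theorem eventually_cutoff {L z : ℝ} (hz : z ∈ Set.Ioo (-L) L) :
    ∀ᶠ n : ℕ in atTop, cutoff L (n + 1) z = 1 ∧ cutoffDeriv L (n + 1) z = 0 := by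
  have h1 : ∀ {d : ℝ}, 0 < d → ∀ᶠ n : ℕ in atTop, 1 < ((n : ℝ) + 1) * d - 1 := by
    intro d hd
    have : Tendsto (fun n : ℕ => ((n : ℝ) + 1) * d) atTop atTop :=
      (tendsto_atTop_add_const_right _ _ tendsto_natCast_atTop_atTop).atTop_mul_const hd
    filter_upwards [this.eventually_gt_atTop 2] with n hn
    linarith
  filter_upwards [h1 (sub_pos.2 hz.2), h1 (by linarith [hz.1] : 0 < L + z)] with n ha hb
  simp [cutoff, cutoffDeriv, deriv_smoothTransition_of_one_lt ha,
    deriv_smoothTransition_of_one_lt hb, Real.smoothTransition.one_of_one_le ha.le,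
    Real.smoothTransition.one_of_one_le hb.le]

theorem IsTest.mul_cutoff {L N : ℝ} (hN : 0 < N) {f : ℝ × ℝ → ℂ}
    (hf : ContDiff ℝ (⊤ : ℕ∞) f) (hper : ∀ x z, f (x + 2 * Real.pi, z) = f (x, z)) :
    IsTest L (fun p => f p * (cutoff L N p.2 : ℂ)) where
  smooth := hf.mul (Complex.ofRealCLM.contDiff.comp ((contDiff_cutoff L N).comp contDiff_snd))
  periodic := fun x z => by simp [hper]
  support := by
    refine ⟨L - 1 / N, by simpa using hN, fun x z hz => ?_⟩
    have hz' : cutoff L N z = 0 := by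
      rcases le_abs.1 hz with h | h
      · have : N * (L - z) - 1 ≤ 0 := by
          have : N * (L - z) ≤ N * (1 / N) := by gcongr; linarith
          rw [mul_one_div_cancel hN.ne'] at this
          linarith
        simp [cutoff, Real.smoothTransition.zero_of_nonpos this]
      · have : N * (L + z) - 1 ≤ 0 := by
          have : N * (L + z) ≤ N * (1 / N) := by gcongr; linarith
          rw [mul_one_div_cancel hN.ne'] at this
          linarith
        simp [cutoff, Real.smoothTransition.zero_of_nonpos this]
    simp [hz']

theorem fderiv_mul_cutoff {L N : ℝ} {f : ℝ × ℝ → ℂ} (hf : ContDiff ℝ (⊤ : ℕ∞) f)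
    (p e : ℝ × ℝ) :
    fderiv ℝ (fun p => f p * (cutoff L N p.2 : ℂ)) p e
      = fderiv ℝ f p e * cutoff L N p.2 + f p * (cutoffDeriv L N p.2 * e.2 : ℝ) := by
  have h1 : HasFDerivAt f (fderiv ℝ f p) p := (hf.differentiable (by simp) p).hasFDerivAt
  have h2 : HasFDerivAt (fun p : ℝ × ℝ => (cutoff L N p.2 : ℂ))
      (Complex.ofRealCLM.comp ((ContinuousLinearMap.toSpanSingleton ℝ (cutoffDeriv L N p.2)).comp
        (ContinuousLinearMap.snd ℝ ℝ ℝ))) p :=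
    Complex.ofRealCLM.hasFDerivAt.comp p
      ((hasDerivAt_cutoff L N p.2).hasFDerivAt.comp p hasFDerivAt_snd)
  rw [HasFDerivAt.fderiv (f := fun p => f p * (cutoff L N p.2 : ℂ)) (h1.mul h2)]
  simp
  ring

/-- Integration by parts in `x` needs no boundary condition at `z = ± L`. -/
theorem integral_val_mul_fderiv_x {L : ℝ} (u : H1per L) {f : ℝ × ℝ → ℂ}
    (hf : ContDiff ℝ (⊤ : ℕ∞) f) (hper : ∀ x z, f (x + 2 * Real.pi, z) = f (x, z)) :
    ∫ p, val u p * fderiv ℝ f p (1, 0) ∂cellMeasure L = -∫ p, dx u p * f p ∂cellMeasure L := by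
  have hfc : Continuous fun p => fderiv ℝ f p (1, 0) :=
    (hf.continuous_fderiv (by simp)).clm_apply continuous_const
  have hlim : ∀ (w : Lp ℂ 2 (cellMeasure L)) {g : ℝ × ℝ → ℂ}, Continuous g →
      Tendsto (fun n : ℕ => ∫ p, w p * (g p * cutoff L (n + 1) p.2) ∂cellMeasure L) atTop
        (𝓝 (∫ p, w p * g p ∂cellMeasure L)) := by
    intro w g hg
    refine tendsto_integral_of_dominated_convergence (fun p => ‖w p * g p‖) (fun n => ?_)
      (integrable_mul_of_continuous w hg).norm (fun n => ae_of_all _ fun p => ?_) ?_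
    · refine (integrable_mul_of_continuous w (hg.mul ?_)).aestronglyMeasurable
      exact Complex.continuous_ofReal.comp ((contDiff_cutoff L _).continuous.comp continuous_snd)
    · rw [← mul_assoc, norm_mul _ (cutoff L (n + 1) p.2 : ℂ), Complex.norm_real, Real.norm_eq_abs]
      exact mul_le_of_le_one_right (norm_nonneg _) (abs_cutoff_le_one _ _ _)
    · refine (ae_restrict_iff' (measurableSet_cell L)).2 (ae_of_all _ fun p hp => ?_)
      refine tendsto_const_nhds.congr' ?_
      filter_upwards [eventually_cutoff hp.2] with n hn
      simp [hn.1]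
  refine tendsto_nhds_unique (hlim (u.1 0) hfc) ?_
  refine (hlim (u.1 1) hf.continuous).neg.congr fun n => ?_
  have := (u.2 _ (IsTest.mul_cutoff (L := L) (N := n + 1) (by positivity) hf hper)).1
  simp only [fderiv_mul_cutoff hf, mul_zero, Complex.ofReal_zero, add_zero] at this
  exact this.symm

/-- Integration by parts in `z` for functions that vanish at `z = ± L`.  Near these sides the
derivative of the cutoff is compensated by the size of the function. -/
theorem integral_val_mul_fderiv_z {L : ℝ} (u : H1per L) {f : ℝ × ℝ → ℂ}
    (hf : ContDiff ℝ (⊤ : ℕ∞) f) (hper : ∀ x z, f (x + 2 * Real.pi, z) = f (x, z))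
    (htop : ∀ x, f (x, L) = 0) (hbot : ∀ x, f (x, -L) = 0) :
    ∫ p, val u p * fderiv ℝ f p (0, 1) ∂cellMeasure L = -∫ p, dz u p * f p ∂cellMeasure L := by
  have hfc : Continuous fun p => fderiv ℝ f p (0, 1) :=
    (hf.continuous_fderiv (by simp)).clm_apply continuous_const
  obtain ⟨K, hK⟩ := ((isCompact_Icc (a := -Real.pi) (b := Real.pi)).prod
    (isCompact_Icc (a := -L) (b := L))).exists_bound_of_continuousOn
      (hf.continuous_fderiv (by simp)).continuousOn
  obtain ⟨D, hD0, hD⟩ := exists_bound_deriv_smoothTransition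
  have hlip : ∀ p ∈ cell L, ‖f p‖ ≤ K * (L - p.2) ∧ ‖f p‖ ≤ K * (L + p.2) := by
    intro p hp
    have hconv : Convex ℝ (Set.Icc (-Real.pi) Real.pi ×ˢ Set.Icc (-L) L) :=
      (convex_Icc _ _).prod (convex_Icc _ _)
    have hx := Set.Ioo_subset_Icc_self hp.1
    have hz := Set.Ioo_subset_Icc_self hp.2
    have hL : -L ≤ L := hz.1.trans hz.2
    have h : ∀ q ∈ Set.Icc (-Real.pi) Real.pi ×ˢ Set.Icc (-L) L,
        DifferentiableAt ℝ f q := fun q _ => hf.differentiable (by simp) q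
    have h1 := hconv.norm_image_sub_le_of_norm_fderiv_le (x := (p.1, L)) (y := p) h hK
      ⟨hx, ⟨hL, le_rfl⟩⟩ ⟨hx, hz⟩
    have h2 := hconv.norm_image_sub_le_of_norm_fderiv_le (x := (p.1, -L)) (y := p) h hK
      ⟨hx, ⟨le_rfl, hL⟩⟩ ⟨hx, hz⟩
    rw [htop, sub_zero] at h1
    rw [hbot, sub_zero] at h2
    have n1 : ‖p - (p.1, L)‖ = L - p.2 := by
      have : |p.2 - L| = L - p.2 := by rw [abs_of_nonpos (by linarith [hz.2])]; ring
      simp [Prod.norm_def, this, hz.2]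
    have n2 : ‖p - (p.1, -L)‖ = L + p.2 := by
      have : |p.2 + L| = L + p.2 := by rw [abs_of_nonneg (by linarith [hz.1])]; ring
      simp [Prod.norm_def, this]
      linarith [hz.1]
    exact ⟨n1 ▸ h1, n2 ▸ h2⟩
  have hK0 : ∀ p ∈ cell L, 0 ≤ K := fun p hp => (norm_nonneg _).trans
    (hK p ⟨Set.Ioo_subset_Icc_self hp.1, Set.Ioo_subset_Icc_self hp.2⟩)
  have hbound : ∀ (n : ℕ), ∀ p ∈ cell L, ‖f p * (cutoffDeriv L (n + 1) p.2 : ℂ)‖ ≤ 4 * K * D := by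
    intro n p hp
    have hKp := hK0 p hp
    obtain ⟨l1, l2⟩ := hlip p hp
    have key : ∀ d : ℝ, 0 ≤ d → ‖f p‖ ≤ K * d →
        ‖f p‖ * |((n : ℝ) + 1) * deriv Real.smoothTransition (((n : ℝ) + 1) * d - 1)|
          ≤ 2 * K * D := by
      intro d hd hfd
      rw [abs_mul, abs_of_pos (by positivity : (0 : ℝ) < n + 1)]
      rcases lt_or_ge 1 (((n : ℝ) + 1) * d - 1) with h | h
      · rw [deriv_smoothTransition_of_one_lt h]
        simp
        positivity
      · calc ‖f p‖ * (((n : ℝ) + 1) * |deriv Real.smoothTransition (((n : ℝ) + 1) * d - 1)|)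
            ≤ (K * d) * (((n : ℝ) + 1) * D) := by
              gcongr
              exact hD _
          _ = K * D * (((n : ℝ) + 1) * d) := by ring
          _ ≤ K * D * 2 := by gcongr; linarith
          _ = 2 * K * D := by ring
    have k1 := key (L - p.2) (by linarith [hp.2.2]) l1
    have k2 := key (L + p.2) (by linarith [hp.2.1]) l2
    rw [norm_mul, Complex.norm_real, Real.norm_eq_abs, cutoffDeriv]
    set a := ((n : ℝ) + 1) * deriv Real.smoothTransition (((n : ℝ) + 1) * (L - p.2) - 1)
    set b := ((n : ℝ) + 1) * deriv Real.smoothTransition (((n : ℝ) + 1) * (L + p.2) - 1)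
    have s1 : |Real.smoothTransition (((n : ℝ) + 1) * (L - p.2) - 1)| ≤ 1 := by
      rw [abs_of_nonneg (Real.smoothTransition.nonneg _)]; exact Real.smoothTransition.le_one _
    have s2 : |Real.smoothTransition (((n : ℝ) + 1) * (L + p.2) - 1)| ≤ 1 := by
      rw [abs_of_nonneg (Real.smoothTransition.nonneg _)]; exact Real.smoothTransition.le_one _
    calc _ ≤ ‖f p‖ * (|a| * 1 + 1 * |b|) := by
          gcongr
          refine (abs_add_le _ _).trans ?_
          rw [neg_mul, abs_mul, abs_neg, abs_mul _ b]
          gcongr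
      _ = ‖f p‖ * |a| + ‖f p‖ * |b| := by ring
      _ ≤ 4 * K * D := by linarith
  have hcut : ∀ n : ℕ, Continuous fun p : ℝ × ℝ => (cutoff L (n + 1) p.2 : ℂ) := fun n =>
    Complex.continuous_ofReal.comp ((contDiff_cutoff L _).continuous.comp continuous_snd)
  have hright : Tendsto (fun n : ℕ => ∫ p, dz u p * (f p * cutoff L (n + 1) p.2) ∂cellMeasure L)
      atTop (𝓝 (∫ p, dz u p * f p ∂cellMeasure L)) := by
    refine tendsto_integral_of_dominated_convergence (fun p => ‖dz u p * f p‖) (fun n => ?_)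
      (integrable_mul_of_continuous (u.1 2) hf.continuous).norm
      (fun n => ae_of_all _ fun p => ?_) ?_
    · exact (integrable_mul_of_continuous (u.1 2)
        (hf.continuous.mul (hcut n))).aestronglyMeasurable
    · rw [← mul_assoc, norm_mul _ (cutoff L (n + 1) p.2 : ℂ), Complex.norm_real, Real.norm_eq_abs]
      exact mul_le_of_le_one_right (norm_nonneg _) (abs_cutoff_le_one _ _ _)
    · refine (ae_restrict_iff' (measurableSet_cell L)).2 (ae_of_all _ fun p hp => ?_)
      refine tendsto_const_nhds.congr' ?_
      filter_upwards [eventually_cutoff hp.2] with n hn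
      simp [hn.1]
  have hleft : Tendsto (fun n : ℕ => ∫ p, val u p *
      fderiv ℝ (fun p => f p * (cutoff L (n + 1) p.2 : ℂ)) p (0, 1) ∂cellMeasure L)
      atTop (𝓝 (∫ p, val u p * fderiv ℝ f p (0, 1) ∂cellMeasure L)) := by
    have hval : Integrable (fun p => val u p) (cellMeasure L) :=
      (Lp.memLp (u.1 0)).integrable (by norm_num)
    refine tendsto_integral_of_dominated_convergence
      (fun p => ‖val u p * fderiv ℝ f p (0, 1)‖ + ‖val u p‖ * (4 * K * D)) (fun n => ?_)
      ((integrable_mul_of_continuous (u.1 0) hfc).norm.add (hval.norm.mul_const _)) (fun n => ?_) ?_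
    · exact (integrable_mul_of_continuous (u.1 0)
        ((IsTest.mul_cutoff (L := L) (N := n + 1) (by positivity) hf
          hper).continuous_fderiv_apply _)).aestronglyMeasurable
    · refine (ae_restrict_iff' (measurableSet_cell L)).2 (ae_of_all _ fun p hp => ?_)
      rw [fderiv_mul_cutoff hf, mul_one, mul_add, ← mul_assoc]
      refine (norm_add_le _ _).trans (add_le_add ?_ ?_)
      · rw [norm_mul _ (cutoff L (n + 1) p.2 : ℂ), Complex.norm_real, Real.norm_eq_abs]
        exact mul_le_of_le_one_right (norm_nonneg _) (abs_cutoff_le_one _ _ _)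
      · rw [norm_mul]
        exact mul_le_mul_of_nonneg_left (hbound n p hp) (norm_nonneg _)
    · refine (ae_restrict_iff' (measurableSet_cell L)).2 (ae_of_all _ fun p hp => ?_)
      refine tendsto_const_nhds.congr' ?_
      filter_upwards [eventually_cutoff hp.2] with n hn
      rw [fderiv_mul_cutoff hf, hn.1, hn.2]
      simp
  refine tendsto_nhds_unique hleft ?_
  refine hright.neg.congr fun n => ?_
  exact ((u.2 _ (IsTest.mul_cutoff (L := L) (N := n + 1) (by positivity) hf hper)).2).symm

/-! ### Fourier coefficients of the trace lie in `H^{1/2}` -/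

theorem continuous_harmonic (m : ℤ) : Continuous (harmonic m) := by
  unfold harmonic
  fun_prop

theorem norm_harmonic (m : ℤ) (p : ℝ × ℝ) : ‖harmonic m p‖ = 1 := by
  have : harmonic m p = Complex.exp (((-(m * p.1) : ℝ) : ℂ) * Complex.I) := by
    rw [harmonic]
    congr 1
    push_cast
    ring
  rw [this, Complex.norm_exp_ofReal_mul_I]

theorem harmonic_periodic (m : ℤ) (x z : ℝ) :
    harmonic m (x + 2 * Real.pi, z) = harmonic m (x, z) := by
  simp only [harmonic]
  rw [Complex.exp_eq_exp_iff_exists_int]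
  refine ⟨-m, ?_⟩
  push_cast
  ring

theorem contDiff_harmonic (m : ℤ) : ContDiff ℝ (⊤ : ℕ∞) (harmonic m) := by
  unfold harmonic
  have : ContDiff ℝ (⊤ : ℕ∞) fun p : ℝ × ℝ => (p.1 : ℂ) :=
    Complex.ofRealCLM.contDiff.comp contDiff_fst
  exact ((contDiff_const.mul this).neg).cexp

theorem fderiv_mul_harmonic {w : ℝ → ℝ} {w' : ℝ} (m : ℤ) (p : ℝ × ℝ)
    (hw : HasDerivAt w w' p.2) :
    fderiv ℝ (fun p : ℝ × ℝ => (w p.2 : ℂ) * harmonic m p) p (1, 0)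
        = -(Complex.I * m) * (w p.2 * harmonic m p) ∧
      fderiv ℝ (fun p : ℝ × ℝ => (w p.2 : ℂ) * harmonic m p) p (0, 1)
        = w' * harmonic m p := by
  have h1 : HasFDerivAt (fun p : ℝ × ℝ => (w p.2 : ℂ))
      (Complex.ofRealCLM.comp ((ContinuousLinearMap.toSpanSingleton ℝ w').comp
        (ContinuousLinearMap.snd ℝ ℝ ℝ))) p :=
    Complex.ofRealCLM.hasFDerivAt.comp p (hw.hasFDerivAt.comp p hasFDerivAt_snd)
  have h0 : HasFDerivAt (fun p : ℝ × ℝ => (p.1 : ℂ))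
      (Complex.ofRealCLM.comp (ContinuousLinearMap.fst ℝ ℝ ℝ)) p :=
    Complex.ofRealCLM.hasFDerivAt.comp p hasFDerivAt_fst
  have h2 : HasFDerivAt (harmonic m) _ p := ((h0.const_mul (Complex.I * m)).neg).cexp
  have h3 := HasFDerivAt.fderiv (f := fun p : ℝ × ℝ => (w p.2 : ℂ) * harmonic m p) (h1.mul h2)
  rw [h3]
  constructor
  · simp [harmonic]
    ring
  · simp
    ring

/-- The functions `e^{|m|(z - L)} e^{-imx}`, harmonic and concentrated near `z = L`. -/
def edgeMode (L : ℝ) (m : ℤ) (p : ℝ × ℝ) : ℂ :=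
  (Real.exp (|(m : ℝ)| * (p.2 - L)) : ℝ) * harmonic m p

theorem contDiff_edgeMode (L : ℝ) (m : ℤ) : ContDiff ℝ (⊤ : ℕ∞) (edgeMode L m) := by
  unfold edgeMode
  exact ContDiff.mul (Complex.ofRealCLM.contDiff.comp
    (f := fun p : ℝ × ℝ => Real.exp (|(m : ℝ)| * (p.2 - L))) (by fun_prop)) (contDiff_harmonic m)

theorem continuous_conj_edgeMode (L : ℝ) (m : ℤ) : Continuous fun p => conj (edgeMode L m p) :=
  Complex.continuous_conj.comp (contDiff_edgeMode L m).continuous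

/-- The conjugates of the edge modes as elements of `L²`. -/
def edgeVec (L : ℝ) (m : ℤ) : Lp ℂ 2 (cellMeasure L) := toL2 L (continuous_conj_edgeMode L m)

theorem inner_edgeVec (L : ℝ) (m : ℤ) (w : Lp ℂ 2 (cellMeasure L)) :
    ⟪edgeVec L m, w⟫_ℂ = ∫ p, w p * edgeMode L m p ∂cellMeasure L := by
  simp [edgeVec, inner_toL2]

theorem integral_exp_period (k : ℤ) :
    ∫ x in Set.Ioo (-Real.pi) Real.pi, Complex.exp (Complex.I * k * x)
      = if k = 0 then (2 * Real.pi : ℂ) else 0 := by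
  rw [← integral_Ioc_eq_integral_Ioo, ← intervalIntegral.integral_of_le (by linarith [Real.pi_pos])]
  split_ifs with h
  · simp [h]
    ring
  · have hk : Complex.I * k ≠ 0 := mul_ne_zero Complex.I_ne_zero (by exact_mod_cast h)
    rw [integral_exp_mul_complex hk]
    have : Complex.exp (Complex.I * k * (Real.pi : ℝ))
        = Complex.exp (Complex.I * k * ((-Real.pi : ℝ) : ℂ)) := by
      rw [Complex.exp_eq_exp_iff_exists_int]
      refine ⟨k, ?_⟩
      push_cast
      ring
    rw [this, sub_self, zero_div]

theorem inner_edgeVec_edgeVec (L : ℝ) (m n : ℤ) :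
    ⟪edgeVec L m, edgeVec L n⟫_ℂ = if m = n then
      (2 * Real.pi : ℂ) * ((∫ z in Set.Ioo (-L) L, Real.exp (2 * |(m : ℝ)| * (z - L)) : ℝ) : ℂ)
      else 0 := by
  rw [inner_edgeVec]
  have h1 : ∫ p, edgeVec L n p * edgeMode L m p ∂cellMeasure L
      = ∫ p : ℝ × ℝ, Complex.exp (Complex.I * ((n - m : ℤ) : ℂ) * p.1)
        * ((Real.exp (|(n : ℝ)| * (p.2 - L)) * Real.exp (|(m : ℝ)| * (p.2 - L)) : ℝ) : ℂ)
        ∂((volume.restrict (Set.Ioo (-Real.pi) Real.pi)).prod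
          (volume.restrict (Set.Ioo (-L) L))) := by
    rw [Measure.prod_restrict, ← Measure.volume_eq_prod]
    refine integral_congr_ae ?_
    filter_upwards [toL2_coeFn L (continuous_conj_edgeMode L n)] with p hp
    change toL2 L (continuous_conj_edgeMode L n) p * _ = _
    rw [hp]
    simp only [edgeMode, harmonic, map_mul, Complex.conj_ofReal, ← Complex.exp_conj, map_neg,
      Complex.conj_I, map_intCast]
    rw [show Complex.I * ((n - m : ℤ) : ℂ) * p.1
      = -(-Complex.I * n * p.1) + -(Complex.I * m * p.1) by push_cast; ring, Complex.exp_add]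
    push_cast
    ring
  rw [h1, integral_prod_mul (fun x : ℝ => Complex.exp (Complex.I * ((n - m : ℤ) : ℂ) * x))
    (fun z : ℝ => ((Real.exp (|(n : ℝ)| * (z - L)) * Real.exp (|(m : ℝ)| * (z - L)) : ℝ) : ℂ)),
    integral_exp_period, integral_complex_ofReal]
  by_cases h : m = n
  · subst h
    simp only [sub_self, if_true, ← Real.exp_add, ← two_mul, mul_assoc]
  · have : n - m ≠ 0 := sub_ne_zero.2 (Ne.symm h)
    simp [h, this]

theorem norm_edgeVec_sq {L : ℝ} (hL : 0 < L) (m : ℤ) :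
    0 < ‖edgeVec L m‖ ^ 2 ∧ |(m : ℝ)| * ‖edgeVec L m‖ ^ 2 ≤ Real.pi := by
  have h := inner_edgeVec_edgeVec L m m
  rw [inner_self_eq_norm_sq_to_K, if_pos rfl] at h
  have h' : ‖edgeVec L m‖ ^ 2
      = 2 * Real.pi * ∫ z in Set.Ioo (-L) L, Real.exp (2 * |(m : ℝ)| * (z - L)) := by
    apply Complex.ofReal_injective
    rw [Complex.ofReal_pow, Complex.ofReal_mul, Complex.ofReal_mul, Complex.ofReal_ofNat]
    exact h
  have hle : -L < L := by linarith
  rw [← integral_Ioc_eq_integral_Ioo, ← intervalIntegral.integral_of_le hle.le] at h'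
  have hc : Continuous fun z : ℝ => Real.exp (2 * |(m : ℝ)| * (z - L)) := by fun_prop
  have hpos : 0 < ∫ z in (-L)..L, Real.exp (2 * |(m : ℝ)| * (z - L)) :=
    intervalIntegral.intervalIntegral_pos_of_pos (hc.intervalIntegrable _ _)
      (fun z => Real.exp_pos _) hle
  have hftc : ∫ z in (-L)..L, Real.exp (2 * |(m : ℝ)| * (z - L)) * (2 * |(m : ℝ)|)
      = Real.exp (2 * |(m : ℝ)| * (L - L)) - Real.exp (2 * |(m : ℝ)| * (-L - L)) := by
    refine intervalIntegral.integral_eq_sub_of_hasDerivAt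
      (f := fun z => Real.exp (2 * |(m : ℝ)| * (z - L))) (fun z _ => ?_)
      ((hc.mul continuous_const).intervalIntegrable _ _)
    have : HasDerivAt (fun z => 2 * |(m : ℝ)| * (z - L)) (2 * |(m : ℝ)|) z := by
      simpa using ((hasDerivAt_id z).sub_const L).const_mul (2 * |(m : ℝ)|)
    exact this.exp
  rw [intervalIntegral.integral_mul_const] at hftc
  refine ⟨by rw [h']; exact mul_pos (by positivity) hpos, ?_⟩
  have he : Real.exp (2 * |(m : ℝ)| * (L - L)) = 1 := by simp
  have he' := Real.exp_pos (2 * |(m : ℝ)| * (-L - L))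
  rw [h']
  calc |(m : ℝ)| * (2 * Real.pi * ∫ z in (-L)..L, Real.exp (2 * |(m : ℝ)| * (z - L)))
      = Real.pi * ((∫ z in (-L)..L, Real.exp (2 * |(m : ℝ)| * (z - L))) * (2 * |(m : ℝ)|)) := by
        ring
    _ ≤ Real.pi * 1 := by
        gcongr
        rw [hftc, he]
        linarith
    _ = Real.pi := mul_one _

/-- Bessel's inequality for the edge modes, whose squared norms are at most `π / |m|`. -/
theorem summable_inner_edgeVec {L : ℝ} (hL : 0 < L) (w : Lp ℂ 2 (cellMeasure L)) :
    Summable fun m : ℤ => |(m : ℝ)| * ‖⟪edgeVec L m, w⟫_ℂ‖ ^ 2 := by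
  have hne : ∀ m, ‖edgeVec L m‖ ≠ 0 := fun m h => by
    have := (norm_edgeVec_sq hL m).1
    rw [h] at this
    simp at this
  have hv : Orthonormal ℂ fun m : ℤ => ((‖edgeVec L m‖ : ℂ)⁻¹) • edgeVec L m := by
    refine ⟨fun m => ?_, fun m n h => ?_⟩
    · rw [norm_smul, norm_inv, Complex.norm_real, norm_norm, inv_mul_cancel₀ (hne m)]
    · simp [inner_smul_left, inner_smul_right, inner_edgeVec_edgeVec, h]
  refine ((hv.inner_products_summable w).mul_left Real.pi).of_nonneg_of_le
    (fun m => by positivity) fun m => ?_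
  rw [inner_smul_left, norm_mul, mul_pow, RCLike.norm_conj, norm_inv, Complex.norm_real, norm_norm,
    ← mul_assoc]
  gcongr
  rw [inv_pow, ← div_eq_mul_inv, le_div_iff₀ (norm_edgeVec_sq hL m).1]
  exact (norm_edgeVec_sq hL m).2

theorem integrable_val {L : ℝ} (u : H1per L) {g : ℝ × ℝ → ℂ} (hg : Continuous g) :
    Integrable (fun p => val u p * g p) (cellMeasure L) := integrable_mul_of_continuous (u.1 0) hg

theorem integrable_dz {L : ℝ} (u : H1per L) {g : ℝ × ℝ → ℂ} (hg : Continuous g) :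
    Integrable (fun p => dz u p * g p) (cellMeasure L) := integrable_mul_of_continuous (u.1 2) hg

theorem integral_linear_combination {α : Type*} [MeasurableSpace α] {μ : Measure α}
    {f g h : α → ℂ} (hf : Integrable f μ) (hg : Integrable g μ) (hh : Integrable h μ) (c e : ℂ) :
    ∫ p, (c * f p - g p - e * h p) ∂μ = c * ∫ p, f p ∂μ - ∫ p, g p ∂μ - e * ∫ p, h p ∂μ := by
  rw [← integral_const_mul, ← integral_const_mul, ← integral_sub (hf.const_mul c) hg]
  exact integral_sub ((hf.const_mul c).sub hg) (hh.const_mul e)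

theorem traceTop_eq {L : ℝ} (u : H1per L) (m : ℤ) :
    traceTop u m = (2 * Real.pi : ℂ)⁻¹ *
      (∫ p, dz u p * ((((p.2 + L) / (2 * L) : ℝ) : ℂ) * harmonic m p) ∂cellMeasure L
        + ∫ p, val u p * (((1 / (2 * L) : ℝ) : ℂ) * harmonic m p) ∂cellMeasure L) := by
  have hm := continuous_harmonic m
  rw [traceTop, ← integral_add (integrable_dz u (by fun_prop)) (integrable_val u (by fun_prop))]
  congr 2
  funext p
  ring

theorem traceBot_eq {L : ℝ} (u : H1per L) (m : ℤ) :
    traceBot u m = -((2 * Real.pi : ℂ)⁻¹ *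
      (∫ p, dz u p * ((((L - p.2) / (2 * L) : ℝ) : ℂ) * harmonic m p) ∂cellMeasure L
        + ∫ p, val u p * (((-1 / (2 * L) : ℝ) : ℂ) * harmonic m p) ∂cellMeasure L)) := by
  have hm := continuous_harmonic m
  rw [traceBot, ← integral_add (integrable_dz u (by fun_prop)) (integrable_val u (by fun_prop))]
  congr 3
  funext p
  ring

/-- The Fourier coefficients on the two sides, computed with the harmonic weight `e^{|m|(z - L)}`
in place of an affine one. -/
theorem traceTop_sub_traceBot {L : ℝ} (hL : 0 < L) (u : H1per L) {m : ℤ} (hm : m ≠ 0) :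
    traceTop u m - (Real.exp (-(2 * |(m : ℝ)| * L)) : ℝ) * traceBot u m
      = (2 * Real.pi : ℂ)⁻¹ * (⟪edgeVec L m, u.1 2⟫_ℂ
        + (|(m : ℝ)| : ℝ) * (Complex.I * m)⁻¹ * ⟪edgeVec L m, u.1 1⟫_ℂ) := by
  set e := Real.exp (-(2 * |(m : ℝ)| * L)) with he
  have hI : Complex.I * (m : ℂ) ≠ 0 := mul_ne_zero Complex.I_ne_zero (by exact_mod_cast hm)
  have hL2 : 2 * L ≠ 0 := by positivity
  have hh := continuous_harmonic m
  -- The difference of the harmonic weight and the affine one with the same boundary values.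
  let w : ℝ → ℝ := fun z => Real.exp (|(m : ℝ)| * (z - L)) - (z + L) / (2 * L)
    - e * ((L - z) / (2 * L))
  have hχ : ∀ z, HasDerivAt (fun z => Real.exp (|(m : ℝ)| * (z - L)))
      (|(m : ℝ)| * Real.exp (|(m : ℝ)| * (z - L))) z := by
    intro z
    have : HasDerivAt (fun z => |(m : ℝ)| * (z - L)) (|(m : ℝ)|) z := by
      simpa using ((hasDerivAt_id z).sub_const L).const_mul (|(m : ℝ)|)
    simpa [mul_comm] using this.exp
  have hw : ∀ z, HasDerivAt w (|(m : ℝ)| * Real.exp (|(m : ℝ)| * (z - L)) - 1 / (2 * L)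
      - e * (-1 / (2 * L))) z := fun z =>
    ((hχ z).sub (((hasDerivAt_id z).add_const L).div_const (2 * L))).sub
      ((((hasDerivAt_id z).const_sub L).div_const (2 * L)).const_mul e)
  have hwsmooth : ContDiff ℝ (⊤ : ℕ∞) fun p : ℝ × ℝ => (w p.2 : ℂ) * harmonic m p := by
    exact ContDiff.mul (Complex.ofRealCLM.contDiff.comp
      (f := fun p : ℝ × ℝ => w p.2) (by fun_prop)) (contDiff_harmonic m)
  have hwtop : w L = 0 := by
    simp [w, ← two_mul, div_self hL2]
  have hwbot : w (-L) = 0 := by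
    have h1 : |(m : ℝ)| * (-L - L) = -(2 * |(m : ℝ)| * L) := by ring
    have h2 : (L - -L) / (2 * L) = 1 := by rw [sub_neg_eq_add, ← two_mul, div_self hL2]
    simp only [w, h1, h2, ← he]
    simp
  have Z := integral_val_mul_fderiv_z u hwsmooth
    (fun x z => by simp [harmonic_periodic]) (fun x => by simp [hwtop]) (fun x => by simp [hwbot])
  have X := integral_val_mul_fderiv_x u (contDiff_edgeMode L m)
    (fun x z => by simp [edgeMode, harmonic_periodic])
  have X' : ∫ p, val u p * edgeMode L m p ∂cellMeasure L
      = (Complex.I * m)⁻¹ * ∫ p, dx u p * edgeMode L m p ∂cellMeasure L := by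
    have : ∀ p, val u p * fderiv ℝ (edgeMode L m) p (1, 0)
        = -(Complex.I * m) * (val u p * edgeMode L m p) := by
      intro p
      have := (fderiv_mul_harmonic m p (hχ p.2)).1
      unfold edgeMode
      rw [this]
      ring
    simp only [this] at X
    rw [integral_const_mul] at X
    rw [eq_inv_mul_iff_mul_eq₀ hI]
    linear_combination -X
  have ce := (contDiff_edgeMode L m).continuous
  have Z1 : ∫ p, val u p * fderiv ℝ (fun p : ℝ × ℝ => (w p.2 : ℂ) * harmonic m p) p (0, 1)
      ∂cellMeasure L = (|(m : ℝ)| : ℝ) * ∫ p, val u p * edgeMode L m p ∂cellMeasure L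
        - ∫ p, val u p * (((1 / (2 * L) : ℝ) : ℂ) * harmonic m p) ∂cellMeasure L
        - e * ∫ p, val u p * (((-1 / (2 * L) : ℝ) : ℂ) * harmonic m p) ∂cellMeasure L := by
    refine Eq.trans ?_ (integral_linear_combination (integrable_val u ce)
      (integrable_val u (by fun_prop)) (integrable_val u (by fun_prop)) _ _)
    refine integral_congr_ae (ae_of_all _ fun p => ?_)
    simp only [(fderiv_mul_harmonic m p (hw p.2)).2, edgeMode]
    push_cast
    ring
  have Z2 : ∫ p, dz u p * ((w p.2 : ℂ) * harmonic m p) ∂cellMeasure L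
      = ∫ p, dz u p * edgeMode L m p ∂cellMeasure L
        - ∫ p, dz u p * ((((p.2 + L) / (2 * L) : ℝ) : ℂ) * harmonic m p) ∂cellMeasure L
        - e * ∫ p, dz u p * ((((L - p.2) / (2 * L) : ℝ) : ℂ) * harmonic m p) ∂cellMeasure L := by
    rw [← one_mul (∫ p, dz u p * edgeMode L m p ∂cellMeasure L)]
    refine Eq.trans ?_ (integral_linear_combination (integrable_dz u ce)
      (integrable_dz u (by fun_prop)) (integrable_dz u (by fun_prop)) _ _)
    refine integral_congr_ae (ae_of_all _ fun p => ?_)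
    simp only [w, edgeMode]
    push_cast
    ring
  rw [Z1, Z2, X'] at Z
  rw [traceTop_eq, traceBot_eq, inner_edgeVec, inner_edgeVec]
  change _ = (2 * Real.pi : ℂ)⁻¹ * (∫ p, dz u p * edgeMode L m p ∂cellMeasure L + _ *
    ∫ p, dx u p * edgeMode L m p ∂cellMeasure L)
  linear_combination -(2 * Real.pi : ℂ)⁻¹ * Z

theorem exists_bound_traceBot {L : ℝ} (u : H1per L) : ∃ C, ∀ m, ‖traceBot u m‖ ≤ C := by
  refine ⟨‖(2 * Real.pi : ℂ)⁻¹‖ * ∫ p, ‖dz u p * (((L - p.2) / (2 * L) : ℝ) : ℂ)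
    + val u p * ((-1 / (2 * L) : ℝ) : ℂ)‖ ∂cellMeasure L, fun m => ?_⟩
  rw [traceBot, norm_neg, norm_mul]
  gcongr
  refine (norm_integral_le_integral_norm _).trans_eq ?_
  simp [norm_harmonic]

theorem summable_abs_mul_exp {c : ℝ} (hc : 0 < c) :
    Summable fun m : ℤ => |(m : ℝ)| * Real.exp (-(c * |(m : ℝ)|)) := by
  have h : Summable fun n : ℕ => (n : ℝ) * Real.exp (-(c * n)) := by
    simpa using Real.summable_pow_mul_exp_neg_nat_mul 1 hc
  refine Summable.of_nat_of_neg ?_ ?_ <;> simpa using h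

/-- The trace of a function in `H¹` on `z = L` belongs to `H^{1/2}`. -/
theorem summable_traceTop {L : ℝ} (hL : 0 < L) (u : H1per L) :
    Summable fun m : ℤ => |(m : ℝ)| * ‖traceTop u m‖ ^ 2 := by
  obtain ⟨C, hC⟩ := exists_bound_traceBot u
  have hsum := ((((summable_inner_edgeVec hL (u.1 2)).add
    (summable_inner_edgeVec hL (u.1 1))).mul_left (4 * ‖(2 * Real.pi : ℂ)⁻¹‖ ^ 2)).add
    ((summable_abs_mul_exp (c := 4 * L) (by positivity)).mul_left (2 * C ^ 2)))
  refine hsum.of_nonneg_of_le (fun m => by positivity) fun m => ?_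
  rcases eq_or_ne m 0 with rfl | hm
  · simp
  set a := ‖⟪edgeVec L m, u.1 2⟫_ℂ‖
  set b := ‖⟪edgeVec L m, u.1 1⟫_ℂ‖
  set k := ‖(2 * Real.pi : ℂ)⁻¹‖
  have hunit : ‖((|(m : ℝ)| : ℝ) : ℂ) * (Complex.I * m)⁻¹‖ = 1 := by
    have : |(m : ℝ)| ≠ 0 := by simpa using hm
    simp [this]
  have h1 : ‖traceTop u m‖ ≤ k * (a + b) + Real.exp (-(2 * |(m : ℝ)| * L)) * C := by
    have h := traceTop_sub_traceBot hL u hm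
    rw [sub_eq_iff_eq_add] at h
    rw [h]
    refine (norm_add_le _ _).trans (add_le_add ?_ ?_)
    · rw [norm_mul]
      gcongr
      refine (norm_add_le _ _).trans ?_
      rw [norm_mul, hunit, one_mul]
    · rw [norm_mul, Complex.norm_real, Real.norm_eq_abs, abs_of_pos (Real.exp_pos _)]
      gcongr
      exact hC m
  have h2 : Real.exp (-(2 * |(m : ℝ)| * L)) ^ 2 = Real.exp (-(4 * L * |(m : ℝ)|)) := by
    rw [← Real.exp_nat_mul]
    congr 1
    push_cast
    ring
  have h3 : ‖traceTop u m‖ ^ 2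
      ≤ 4 * k ^ 2 * (a ^ 2 + b ^ 2) + 2 * C ^ 2 * Real.exp (-(4 * L * |(m : ℝ)|)) := by
    rw [← h2]
    calc ‖traceTop u m‖ ^ 2 ≤ (k * (a + b) + Real.exp (-(2 * |(m : ℝ)| * L)) * C) ^ 2 := by gcongr
      _ ≤ _ := by
        nlinarith [sq_nonneg (k * (a + b) - Real.exp (-(2 * |(m : ℝ)| * L)) * C),
          mul_nonneg (sq_nonneg k) (sq_nonneg (a - b))]
  calc |(m : ℝ)| * ‖traceTop u m‖ ^ 2
      ≤ |(m : ℝ)| * (4 * k ^ 2 * (a ^ 2 + b ^ 2) + 2 * C ^ 2 * Real.exp (-(4 * L * |(m : ℝ)|))) := by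
        gcongr
    _ = _ := by ring

/-! ### Reflection in the mirror line -/

/-- The reflection `(x, z) ↦ (x, -z)`. -/
def mirror : ℝ × ℝ ≃ᵐ ℝ × ℝ := (MeasurableEquiv.refl ℝ).prodCongr (MeasurableEquiv.neg ℝ)

@[simp] theorem mirror_apply (p : ℝ × ℝ) : mirror p = (p.1, -p.2) := rfl

theorem measurePreserving_mirror (L : ℝ) :
    MeasurePreserving mirror (cellMeasure L) (cellMeasure L) := by
  have h : MeasurePreserving mirror (volume : Measure (ℝ × ℝ)) volume :=
    (MeasurePreserving.id volume).prod (Measure.measurePreserving_neg volume)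
  have h2 := h.restrict_preimage (measurableSet_cell L)
  have h3 : mirror ⁻¹' cell L = cell L := by
    ext p
    simp only [cell, Set.mem_preimage, mirror_apply, Set.mem_prod, Set.mem_Ioo]
    constructor <;> rintro ⟨a, b, c⟩ <;> exact ⟨a, by linarith, by linarith⟩
  rwa [h3] at h2

theorem integral_comp_mirror (L : ℝ) (g : ℝ × ℝ → ℂ) :
    ∫ p, g (mirror p) ∂cellMeasure L = ∫ p, g p ∂cellMeasure L :=
  (measurePreserving_mirror L).integral_comp' g

theorem mirror_mirror (p : ℝ × ℝ) : mirror (mirror p) = p := by simp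

theorem IsTest.comp_mirror {L : ℝ} {f : ℝ × ℝ → ℂ} (hf : IsTest L f) :
    IsTest L (fun p => f (mirror p)) where
  smooth := hf.smooth.comp (contDiff_fst.prodMk contDiff_snd.neg)
  periodic := fun x z => hf.periodic x (-z)
  support := by
    obtain ⟨r, hr, h⟩ := hf.support
    exact ⟨r, hr, fun x z hz => h x (-z) (by rwa [abs_neg])⟩

theorem fderiv_comp_mirror {f : ℝ × ℝ → ℂ} (hf : ContDiff ℝ (⊤ : ℕ∞) f) (p e : ℝ × ℝ) :
    fderiv ℝ (fun p => f (mirror p)) p e = fderiv ℝ f (mirror p) (mirror e) := by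
  have h1 : HasFDerivAt (fun p : ℝ × ℝ => mirror p)
      ((ContinuousLinearMap.fst ℝ ℝ ℝ).prod (-ContinuousLinearMap.snd ℝ ℝ ℝ)) p :=
    hasFDerivAt_fst.prodMk hasFDerivAt_snd.neg
  have h2 : HasFDerivAt f (fderiv ℝ f (mirror p)) (mirror p) :=
    (hf.differentiable (by simp) _).hasFDerivAt
  rw [HasFDerivAt.fderiv (f := fun p => f (mirror p)) (h2.comp p h1)]
  rfl

/-- Reflection of a square-integrable function. -/
def reflectL2 {L : ℝ} (w : Lp ℂ 2 (cellMeasure L)) : Lp ℂ 2 (cellMeasure L) :=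
  Lp.compMeasurePreserving mirror (measurePreserving_mirror L) w

theorem reflectL2_coeFn {L : ℝ} (w : Lp ℂ 2 (cellMeasure L)) :
    reflectL2 w =ᵐ[cellMeasure L] fun p => w (mirror p) :=
  Lp.coeFn_compMeasurePreserving w (measurePreserving_mirror L)

theorem integral_reflectL2_mul {L : ℝ} (w : Lp ℂ 2 (cellMeasure L)) (g : ℝ × ℝ → ℂ) :
    ∫ p, reflectL2 w p * g p ∂cellMeasure L = ∫ p, w p * g (mirror p) ∂cellMeasure L := by
  rw [← integral_comp_mirror L fun p => w p * g (mirror p)]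
  refine integral_congr_ae ?_
  filter_upwards [reflectL2_coeFn w] with p hp
  rw [hp, mirror_mirror]

theorem integral_neg_mul {L : ℝ} (w : Lp ℂ 2 (cellMeasure L)) (g : ℝ × ℝ → ℂ) :
    ∫ p, (-w : Lp ℂ 2 (cellMeasure L)) p * g p ∂cellMeasure L
      = -∫ p, w p * g p ∂cellMeasure L := by
  rw [← integral_neg]
  refine integral_congr_ae ?_
  filter_upwards [Lp.coeFn_neg w] with p hp
  rw [hp, Pi.neg_apply, neg_mul]

theorem isWeakGradient_reflect {L : ℝ} (u : H1per L) :
    IsWeakGradient L (WithLp.toLp 2 ![reflectL2 (u.1 0), reflectL2 (u.1 1), -reflectL2 (u.1 2)]) := by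
  intro f hf
  have h := u.2 _ hf.comp_mirror
  simp only [fderiv_comp_mirror hf.smooth] at h
  have e1 : mirror ((1 : ℝ), (0 : ℝ)) = (1, 0) := by simp
  have e2 : mirror ((0 : ℝ), (1 : ℝ)) = -(0, 1) := by simp
  simp only [e1, e2, map_neg, mul_neg, integral_neg] at h
  change (∫ p, reflectL2 (u.1 0) p * _ ∂_ = -∫ p, reflectL2 (u.1 1) p * _ ∂_) ∧
    (∫ p, reflectL2 (u.1 0) p * _ ∂_ = -∫ p, (-reflectL2 (u.1 2) : Lp ℂ 2 (cellMeasure L)) p * _ ∂_)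
  rw [integral_neg_mul, integral_reflectL2_mul, integral_reflectL2_mul, integral_reflectL2_mul,
    integral_reflectL2_mul]
  refine ⟨h.1, ?_⟩
  have h2 := h.2
  rw [neg_inj] at h2
  rw [neg_neg]
  exact h2

/-- The mirror image `u(x, -z)` of a function in `H¹`. -/
def reflect {L : ℝ} (u : H1per L) : H1per L :=
  ⟨WithLp.toLp 2 ![reflectL2 (u.1 0), reflectL2 (u.1 1), -reflectL2 (u.1 2)],
    isWeakGradient_reflect u⟩

theorem val_reflect {L : ℝ} (u : H1per L) :
    val (reflect u) =ᵐ[cellMeasure L] fun p => val u (mirror p) := reflectL2_coeFn (u.1 0)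

theorem dx_reflect {L : ℝ} (u : H1per L) :
    dx (reflect u) =ᵐ[cellMeasure L] fun p => dx u (mirror p) := reflectL2_coeFn (u.1 1)

theorem dz_reflect {L : ℝ} (u : H1per L) :
    dz (reflect u) =ᵐ[cellMeasure L] fun p => -dz u (mirror p) := by
  change ((-reflectL2 (u.1 2) : Lp ℂ 2 (cellMeasure L)) : ℝ × ℝ → ℂ) =ᵐ[cellMeasure L] _
  filter_upwards [Lp.coeFn_neg (reflectL2 (u.1 2)), reflectL2_coeFn (u.1 2)] with p h1 h2
  rw [h1, Pi.neg_apply, h2]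
  rfl

/-- Reflection interchanges the two sides, because it interchanges the two affine weights. -/
theorem traceTop_reflect {L : ℝ} (u : H1per L) (m : ℤ) :
    traceTop (reflect u) m = traceBot u m := by
  rw [traceTop, traceBot, ← mul_neg, ← integral_neg]
  rw [← integral_comp_mirror L fun p => -((dz u p * (((L - p.2) / (2 * L) : ℝ) : ℂ)
    + val u p * ((-1 / (2 * L) : ℝ) : ℂ)) * harmonic m p)]
  congr 1
  refine integral_congr_ae ?_
  filter_upwards [val_reflect u, dz_reflect u] with p h1 h2
  rw [h1, h2]
  simp only [mirror_apply, harmonic]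
  push_cast
  ring

theorem traceBot_reflect {L : ℝ} (u : H1per L) (m : ℤ) :
    traceBot (reflect u) m = traceTop u m := by
  rw [traceTop, traceBot, ← mul_neg, ← integral_neg]
  rw [← integral_comp_mirror L fun p => (dz u p * (((p.2 + L) / (2 * L) : ℝ) : ℂ)
    + val u p * ((1 / (2 * L) : ℝ) : ℂ)) * harmonic m p]
  congr 1
  refine integral_congr_ae ?_
  filter_upwards [val_reflect u, dz_reflect u] with p h1 h2
  rw [h1, h2]
  simp only [mirror_apply, harmonic]
  push_cast
  ring

/-- The trace of a function in `H¹` on `z = -L` belongs to `H^{1/2}`. -/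
theorem summable_traceBot {L : ℝ} (hL : 0 < L) (u : H1per L) :
    Summable fun m : ℤ => |(m : ℝ)| * ‖traceBot u m‖ ^ 2 := by
  simpa only [traceTop_reflect] using summable_traceTop hL (reflect u)

namespace Slab

variable (S : Slab)

/-- The volume part `∫_Ω μ⁻¹ (∇ + iκ)u · (∇ - iκ)v̄` of the form `h`. -/
def volForm (κ : ℂ) (u v : H1per S.L) : ℂ :=
  ∫ p, ((S.mu p)⁻¹ : ℂ) *
      ((dx u p + Complex.I * κ * val u p) * (conj (dx v p) - Complex.I * κ * conj (val v p))
        + dz u p * conj (dz v p)) ∂cellMeasure S.L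

theorem formH_eq (κ ω : ℂ) (u v : H1per S.L) :
    S.formH κ ω u v = S.volForm κ u v + (S.mu0 : ℂ)⁻¹ * S.dtnForm κ ω u v := rfl

theorem conj_volForm (κ : ℝ) (u v : H1per S.L) :
    conj (S.volForm κ u v) = S.volForm κ v u := by
  rw [volForm, volForm, ← integral_conj]
  congr 1
  funext p
  simp only [map_mul, map_add, map_sub, map_inv₀, Complex.conj_conj, Complex.conj_ofReal,
    Complex.conj_I]
  ring

theorem conj_formB (u v : H1per S.L) : conj (S.formB u v) = S.formB v u := by
  rw [formB, formB, ← integral_conj]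
  congr 1
  funext p
  simp only [map_mul, Complex.conj_conj, Complex.conj_ofReal]
  ring

theorem volForm_reflect_left (κ : ℂ) (u v : H1per S.L) :
    S.volForm κ (reflect u) v = S.volForm κ u (reflect v) := by
  rw [volForm, volForm, ← integral_comp_mirror S.L]
  refine integral_congr_ae ?_
  have q := (measurePreserving_mirror S.L).quasiMeasurePreserving
  filter_upwards [q.ae (val_reflect u), q.ae (dx_reflect u), q.ae (dz_reflect u),
    val_reflect v, dx_reflect v, dz_reflect v] with p h1 h2 h3 h4 h5 h6
  rw [h1, h2, h3, h4, h5, h6, mirror_mirror, mirror_apply, S.mu_symm, map_neg]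
  ring

theorem formB_reflect_left (u v : H1per S.L) :
    S.formB (reflect u) v = S.formB u (reflect v) := by
  rw [formB, formB, ← integral_comp_mirror S.L]
  refine integral_congr_ae ?_
  have q := (measurePreserving_mirror S.L).quasiMeasurePreserving
  filter_upwards [q.ae (val_reflect u), val_reflect v] with p h1 h4
  rw [h1, h4, mirror_mirror, mirror_apply, S.ep_symm]

theorem volForm_self (κ : ℝ) (u : H1per S.L) :
    S.volForm κ u u = ((∫ p, (S.mu p)⁻¹ * (‖dx u p + Complex.I * κ * val u p‖ ^ 2
      + ‖dz u p‖ ^ 2) ∂cellMeasure S.L : ℝ) : ℂ) := by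
  rw [volForm, ← integral_complex_ofReal]
  congr 1
  funext p
  push_cast
  rw [← Complex.mul_conj', ← Complex.mul_conj']
  simp only [map_mul, map_add, Complex.conj_ofReal, Complex.conj_I]
  ring

theorem formB_self (u : H1per S.L) :
    S.formB u u = ((∫ p, S.ep p * ‖val u p‖ ^ 2 ∂cellMeasure S.L : ℝ) : ℂ) := by
  rw [formB, ← integral_complex_ofReal]
  congr 1
  funext p
  push_cast
  rw [← Complex.mul_conj']

theorem volForm_self_im (κ : ℝ) (u : H1per S.L) : (S.volForm κ u u).im = 0 := by
  rw [volForm_self, Complex.ofReal_im]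

theorem formB_self_im (u : H1per S.L) : (S.formB u u).im = 0 := by
  rw [formB_self, Complex.ofReal_im]

/-- Reflection is symmetric for the Hermitian volume form, as the coefficients are even in `z`. -/
theorem volForm_reflect_im (κ : ℝ) (u : H1per S.L) : (S.volForm κ u (reflect u)).im = 0 := by
  rw [← Complex.conj_eq_iff_im, conj_volForm, volForm_reflect_left]

theorem formB_reflect_im (u : H1per S.L) : (S.formB u (reflect u)).im = 0 := by
  rw [← Complex.conj_eq_iff_im, conj_formB, formB_reflect_left]

theorem ep_pos (p : ℝ × ℝ) : 0 < S.ep p := by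
  obtain ⟨lo, hi, hlo, h⟩ := S.ep_bounds
  exact hlo.trans (h p).1

theorem mu_pos (p : ℝ × ℝ) : 0 < S.mu p := by
  obtain ⟨lo, hi, hlo, h⟩ := S.mu_bounds
  exact hlo.trans (h p).1

theorem ep0_pos : 0 < S.ep0 := by
  rw [← S.ep_outside 0 S.L (le_abs_self _)]
  exact S.ep_pos _

theorem mu0_pos : 0 < S.mu0 := by
  rw [← S.mu_outside 0 S.L (le_abs_self _)]
  exact S.mu_pos _

theorem integrable_sq_norm {L : ℝ} (w : Lp ℂ 2 (cellMeasure L)) :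
    Integrable (fun p => ‖w p‖ ^ 2) (cellMeasure L) := (Lp.memLp w).integrable_norm_pow (by simp)

/-- A function in `H¹` for which both quadratic forms vanish is zero. -/
theorem eq_zero_of_forms_eq_zero {κ : ℝ} {u : H1per S.L} (hB : S.formB u u = 0)
    (hV : S.volForm κ u u = 0) : u = 0 := by
  rw [formB_self, Complex.ofReal_eq_zero] at hB
  rw [volForm_self, Complex.ofReal_eq_zero] at hV
  obtain ⟨elo, ehi, helo, he⟩ := S.ep_bounds
  obtain ⟨mlo, mhi, hmlo, hm⟩ := S.mu_bounds
  have hval : ∀ᵐ p ∂cellMeasure S.L, val u p = 0 := by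
    have hi : Integrable (fun p => S.ep p * ‖val u p‖ ^ 2) (cellMeasure S.L) := by
      refine (integrable_sq_norm (u.1 0)).bdd_mul (c := ehi) S.ep_meas.aestronglyMeasurable
        (ae_of_all _ fun p => ?_)
      rw [Real.norm_eq_abs, abs_of_pos (S.ep_pos p)]
      exact (he p).2.le
    have h := (integral_eq_zero_iff_of_nonneg (fun p => mul_nonneg (S.ep_pos p).le
      (sq_nonneg _)) hi).1 hB
    filter_upwards [h] with p hp
    have hp' : S.ep p * ‖val u p‖ ^ 2 = 0 := hp
    simpa [(S.ep_pos p).ne'] using hp'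
  have hgrad : ∀ᵐ p ∂cellMeasure S.L, dx u p = 0 ∧ dz u p = 0 := by
    have hV' : ∫ p, (S.mu p)⁻¹ * (‖dx u p‖ ^ 2 + ‖dz u p‖ ^ 2) ∂cellMeasure S.L = 0 := by
      rw [← hV]
      refine integral_congr_ae ?_
      filter_upwards [hval] with p hp
      simp [hp]
    have hi : Integrable (fun p => (S.mu p)⁻¹ * (‖dx u p‖ ^ 2 + ‖dz u p‖ ^ 2))
        (cellMeasure S.L) := by
      refine ((integrable_sq_norm (u.1 1)).add (integrable_sq_norm (u.1 2))).bdd_mul (c := mlo⁻¹)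
        S.mu_meas.inv.aestronglyMeasurable (ae_of_all _ fun p => ?_)
      rw [Real.norm_eq_abs, abs_of_pos (inv_pos.2 (S.mu_pos p))]
      exact inv_anti₀ hmlo (hm p).1.le
    have h := (integral_eq_zero_iff_of_nonneg (fun p => mul_nonneg (inv_pos.2 (S.mu_pos p)).le
      (add_nonneg (sq_nonneg _) (sq_nonneg _))) hi).1 hV'
    filter_upwards [h] with p hp
    have hp' : (S.mu p)⁻¹ * (‖dx u p‖ ^ 2 + ‖dz u p‖ ^ 2) = 0 := hp
    have hp2 : ‖dx u p‖ ^ 2 + ‖dz u p‖ ^ 2 = 0 := by simpa [(S.mu_pos p).ne'] using hp'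
    constructor <;> rw [← norm_eq_zero] <;> nlinarith [sq_nonneg ‖dx u p‖, sq_nonneg ‖dz u p‖]
  have zero : ∀ w : Lp ℂ 2 (cellMeasure S.L), (∀ᵐ p ∂cellMeasure S.L, w p = 0) → w = 0 := by
    intro w hw
    refine Lp.ext ?_
    filter_upwards [hw, Lp.coeFn_zero ℂ 2 (cellMeasure S.L)] with p h1 h2
    rw [h1, h2, Pi.zero_apply]
  refine Subtype.ext (PiLp.ext fun i => ?_)
  fin_cases i
  · exact zero _ hval
  · exact zero _ (hgrad.mono fun p h => h.1)
  · exact zero _ (hgrad.mono fun p h => h.2)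

end Slab

/-! ### Energy identities -/

/-- Polar form of the branch: its argument is half that of `-is`, turned by `π / 4`. -/
theorem branchSqrt_polar {s : ℂ} (hs : s ≠ 0) :
    branchSqrt s = (√‖s‖ : ℝ)
      * Complex.exp (((Real.pi / 4 + (-Complex.I * s).arg / 2 : ℝ) : ℂ) * Complex.I) := by
  have hne : -Complex.I * s ≠ 0 := mul_ne_zero (neg_ne_zero.2 Complex.I_ne_zero) hs
  have hnorm : ‖-Complex.I * s‖ = ‖s‖ := by simp
  have hsqrt : √‖s‖ = Real.exp (Real.log ‖s‖ / 2) := by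
    rw [Real.exp_half, Real.exp_log (norm_pos_iff.2 hs)]
  rw [branchSqrt, Complex.cpow_def_of_ne_zero hne, Complex.log, hnorm, ← Complex.exp_add, hsqrt,
    Complex.ofReal_exp, ← Complex.exp_add]
  congr 1
  push_cast
  ring

theorem branchSqrt_of_pos {s : ℝ} (hs : 0 < s) : branchSqrt s = (√s : ℝ) := by
  have harg : (-Complex.I * (s : ℂ)).arg = -(Real.pi / 2) := by
    rw [mul_comm, Complex.arg_real_mul _ hs, Complex.arg_neg_I]
  rw [branchSqrt_polar (by exact_mod_cast hs.ne'), harg, Complex.norm_real, Real.norm_eq_abs,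
    abs_of_pos hs]
  have : Real.pi / 4 + -(Real.pi / 2) / 2 = 0 := by ring
  simp [this]

theorem branchSqrt_of_neg {s : ℝ} (hs : s < 0) : branchSqrt s = (√(-s) : ℝ) * Complex.I := by
  have harg : (-Complex.I * (s : ℂ)).arg = Real.pi / 2 := by
    have : -Complex.I * (s : ℂ) = ((-s : ℝ) : ℂ) * Complex.I := by push_cast; ring
    rw [this, Complex.arg_real_mul _ (neg_pos.2 hs), Complex.arg_I]
  rw [branchSqrt_polar (by exact_mod_cast hs.ne), harg, Complex.norm_real, Real.norm_eq_abs,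
    abs_of_neg hs]
  have : Real.pi / 4 + Real.pi / 2 / 2 = Real.pi / 2 := by ring
  rw [this]
  push_cast
  rw [Complex.exp_pi_div_two_mul_I]

/-- The branch of the square root maps the upper half-plane to the first quadrant. -/
theorem branchSqrt_of_im_pos {s : ℂ} (hs : 0 < s.im) :
    0 ≤ (branchSqrt s).re ∧ 0 ≤ (branchSqrt s).im := by
  have hne : s ≠ 0 := by
    rintro rfl
    simp at hs
  have harg : |(-Complex.I * s).arg| < Real.pi / 2 := by
    rw [Complex.abs_arg_lt_pi_div_two_iff]
    left
    simpa using hs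
  obtain ⟨h1, h2⟩ := abs_lt.1 harg
  rw [branchSqrt_polar hne]
  set θ := Real.pi / 4 + (-Complex.I * s).arg / 2
  rw [Complex.re_ofReal_mul, Complex.im_ofReal_mul, Complex.exp_ofReal_mul_I_re,
    Complex.exp_ofReal_mul_I_im]
  have t1 : 0 < θ := by simp only [θ]; linarith
  have t2 : θ < Real.pi / 2 := by simp only [θ]; linarith
  exact ⟨mul_nonneg (Real.sqrt_nonneg _) (Real.cos_nonneg_of_neg_pi_div_two_le_of_le
    (by linarith) t2.le), mul_nonneg (Real.sqrt_nonneg _)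
    (Real.sin_nonneg_of_nonneg_of_le_pi t1.le (by linarith [Real.pi_pos]))⟩

namespace Slab

variable (S : Slab)

theorem isOpen_diamond : IsOpen S.diamond := by
  have e : S.diamond = {q | |q.1| < 1 / 2} ∩ ({q | |q.1| < q.2 * √(S.ep0 * S.mu0)}
      ∩ {q | q.2 * √(S.ep0 * S.mu0) < 1 - |q.1|}) := rfl
  rw [e]
  exact (isOpen_lt (by fun_prop) (by fun_prop)).inter ((isOpen_lt (by fun_prop)
    (by fun_prop)).inter (isOpen_lt (by fun_prop) (by fun_prop)))

theorem omega_pos_of_mem_diamond {κ ω : ℝ} (h : (κ, ω) ∈ S.diamond) : 0 < ω := by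
  have h1 : 0 < ω * √(S.ep0 * S.mu0) := (abs_nonneg _).trans_lt h.2.1
  exact pos_of_mul_pos_left h1 (Real.sqrt_nonneg _)

theorem eta_ofReal (m : ℤ) (κ ω : ℝ) :
    S.eta m κ ω = branchSqrt (((ω * √(S.ep0 * S.mu0)) ^ 2 - (m + κ) ^ 2 : ℝ) : ℂ) := by
  rw [eta, mul_pow, Real.sq_sqrt (mul_pos S.ep0_pos S.mu0_pos).le]
  congr 1
  push_cast
  ring

theorem eta_zero_of_mem_diamond {κ ω : ℝ} (h : (κ, ω) ∈ S.diamond) :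
    ∃ ρ : ℝ, 0 < ρ ∧ S.eta 0 κ ω = ρ := by
  have h1 : 0 < (ω * √(S.ep0 * S.mu0)) ^ 2 - ((0 : ℤ) + κ) ^ 2 := by
    have := sq_lt_sq' (neg_lt_of_abs_lt h.2.1) (lt_of_abs_lt h.2.1)
    simpa using this
  exact ⟨_, Real.sqrt_pos.2 h1, by rw [eta_ofReal, branchSqrt_of_pos h1]⟩

theorem eta_of_mem_diamond {κ ω : ℝ} (h : (κ, ω) ∈ S.diamond) {m : ℤ} (hm : m ≠ 0) :
    ∃ ρ : ℝ, 0 ≤ ρ ∧ ρ ≤ 2 * |(m : ℝ)| ∧ S.eta m κ ω = ρ * Complex.I := by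
  obtain ⟨k1, k2, k3⟩ := h
  simp only at k1 k2 k3
  set c := ω * √(S.ep0 * S.mu0) with hc
  have hm1 : (1 : ℝ) ≤ |(m : ℝ)| := by exact_mod_cast Int.one_le_abs hm
  have hlow : |(m : ℝ)| - |κ| ≤ |(m : ℝ) + κ| := by
    have := abs_sub_abs_le_abs_sub (m : ℝ) (-κ)
    rwa [abs_neg, sub_neg_eq_add] at this
  have hup : |(m : ℝ) + κ| ≤ |(m : ℝ)| + |κ| := abs_add_le _ _
  have hc0 : 0 ≤ c := (abs_nonneg _).trans k2.le
  have hneg : c ^ 2 - (m + κ) ^ 2 < 0 := by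
    rw [← sq_abs ((m : ℝ) + κ)]
    nlinarith
  refine ⟨√(-(c ^ 2 - (m + κ) ^ 2)), Real.sqrt_nonneg _, ?_, ?_⟩
  · refine Real.sqrt_le_iff.2 ⟨by positivity, ?_⟩
    rw [← sq_abs ((m : ℝ) + κ)]
    have : |(m : ℝ) + κ| ≤ 2 * |(m : ℝ)| := by linarith
    nlinarith [abs_nonneg ((m : ℝ) + κ)]
  · rw [eta_ofReal, branchSqrt_of_neg hneg]

/-- Only the propagating harmonic contributes to the imaginary part of the Dirichlet-to-Neumann
form. -/
theorem im_tsum_eta {κ ω : ℝ} (h : (κ, ω) ∈ S.diamond) (u : H1per S.L) {X : ℤ → ℂ}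
    (hX : ∀ m, ‖X m‖ ≤ ‖traceTop u m‖ ^ 2 + ‖traceBot u m‖ ^ 2) (him : ∀ m, (X m).im = 0) :
    (∑' m : ℤ, -Complex.I * S.eta m κ ω * X m).im = (-Complex.I * S.eta 0 κ ω * X 0).im := by
  have hsum : Summable fun m : ℤ => -Complex.I * S.eta m κ ω * X m := by
    refine Summable.of_norm_bounded_eventually (g := fun m : ℤ => 2 * (|(m : ℝ)|
      * ‖traceTop u m‖ ^ 2 + |(m : ℝ)| * ‖traceBot u m‖ ^ 2))
      (((summable_traceTop S.L_pos u).add (summable_traceBot S.L_pos u)).mul_left 2) ?_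
    have hcof : ∀ᶠ m : ℤ in cofinite, m ≠ 0 := (Set.finite_singleton (0 : ℤ)).compl_mem_cofinite
    filter_upwards [hcof] with m hm
    obtain ⟨ρ, h0, h1, h2⟩ := S.eta_of_mem_diamond h hm
    rw [h2, norm_mul, norm_mul, norm_mul, norm_neg, Complex.norm_I, Complex.norm_real, one_mul,
      mul_one, Real.norm_eq_abs, abs_of_nonneg h0]
    calc ρ * ‖X m‖ ≤ 2 * |(m : ℝ)| * (‖traceTop u m‖ ^ 2 + ‖traceBot u m‖ ^ 2) := by
          gcongr
          exact hX m
      _ = _ := by ring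
  rw [Complex.im_tsum hsum]
  refine tsum_eq_single 0 fun m hm => ?_
  obtain ⟨ρ, -, -, h2⟩ := S.eta_of_mem_diamond h hm
  rw [h2]
  simp [him m]

/-- A wave incident from the left is outgoing at `z = L`, so the source acts on `z = -L` only. -/
theorem sourceP_left (κ ω : ℂ) (v : H1per S.L) :
    S.sourceP 1 0 κ ω v = (S.mu0 : ℂ)⁻¹ * (2 * Real.pi * (-2 * Complex.I * S.eta 0 κ ω
      * Complex.exp (-(Complex.I * S.eta 0 κ ω * S.L)) * conj (traceBot v 0))) := by
  have e : Complex.I * S.eta 0 κ ω * ((-S.L : ℝ) : ℂ) = -(Complex.I * S.eta 0 κ ω * S.L) := by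
    push_cast; ring
  rw [sourceP, incident, incident, incidentDeriv, incidentDeriv, e]
  ring

/-- The imaginary part of the variational equation, tested against a function for which the
volume terms are real. -/
theorem im_dtn_eq {κ ω : ℝ} {u v : H1per S.L} (hu : S.IsScattering 1 0 κ ω u)
    (hV : (S.volForm κ u v).im = 0) (hB : (S.formB u v).im = 0) :
    (∑' m : ℤ, -Complex.I * S.eta m κ ω *
      (traceTop u m * conj (traceTop v m) + traceBot u m * conj (traceBot v m))).im
      = (-2 * Complex.I * S.eta 0 κ ω
      * Complex.exp (-(Complex.I * S.eta 0 κ ω * S.L)) * conj (traceBot v 0)).im := by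
  have h := congrArg Complex.im (hu v)
  rw [sourceP_left, formH_eq, dtnForm] at h
  have e1 : (S.mu0 : ℂ)⁻¹ = ((S.mu0⁻¹ : ℝ) : ℂ) := by push_cast; rfl
  have e2 : (2 * Real.pi : ℂ) = ((2 * Real.pi : ℝ) : ℂ) := by push_cast; rfl
  have e3 : (ω : ℂ) ^ 2 = ((ω ^ 2 : ℝ) : ℂ) := by push_cast; rfl
  rw [e1, e2, e3, Complex.sub_im, Complex.add_im, Complex.im_ofReal_mul, Complex.im_ofReal_mul,
    Complex.im_ofReal_mul, Complex.im_ofReal_mul, Complex.im_ofReal_mul, hV, hB, mul_zero, sub_zero,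
    zero_add] at h
  exact mul_left_cancel₀ (by positivity) (mul_left_cancel₀ (inv_pos.2 S.mu0_pos).ne' h)

/-- Conservation of energy and the effect of the mirror symmetry: for every solution `u` the
reflection and transmission coefficients satisfy `|R|² + |T|² = 1` and `Re (R T̄) = 0`. -/
theorem scattering_relations {κ ω : ℝ} (h : (κ, ω) ∈ S.diamond) {u : H1per S.L}
    (hu : S.IsScattering 1 0 κ ω u) {R T : ℂ}
    (hR : R = (traceBot u 0 - Complex.exp (-(Complex.I * S.eta 0 κ ω * S.L)))
      * Complex.exp (-(Complex.I * S.eta 0 κ ω * S.L)))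
    (hT : T = traceTop u 0 * Complex.exp (-(Complex.I * S.eta 0 κ ω * S.L))) :
    Complex.normSq R + Complex.normSq T = 1 ∧ (R * conj T).re = 0 := by
  have E1 := S.im_dtn_eq hu (S.volForm_self_im κ u) (S.formB_self_im u)
  have E2 := S.im_dtn_eq hu (S.volForm_reflect_im κ u) (S.formB_reflect_im u)
  simp only [traceTop_reflect, traceBot_reflect] at E2
  rw [S.im_tsum_eta h u (fun m => (norm_add_le _ _).trans (by simp [sq]))
    (fun m => by simp [Complex.mul_conj])] at E1
  rw [S.im_tsum_eta h u (fun m => (norm_add_le _ _).trans (by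
      simp only [norm_mul, RCLike.norm_conj]
      nlinarith [sq_nonneg (‖traceTop u m‖ - ‖traceBot u m‖)]))
    (fun m => by simp; ring)] at E2
  obtain ⟨ρ, hρ, hη⟩ := S.eta_zero_of_mem_diamond h
  rw [hη] at E1 E2 hR hT
  set e := Complex.exp (-(Complex.I * ρ * S.L)) with he
  have hE : e.re ^ 2 + e.im ^ 2 = 1 := by
    have h1 : ‖e‖ = 1 := by
      have : -(Complex.I * (ρ : ℂ) * S.L) = ((-(ρ * S.L) : ℝ) : ℂ) * Complex.I := by
        push_cast; ring
      rw [he, this, Complex.norm_exp_ofReal_mul_I]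
    have h2 := Complex.sq_norm e
    rw [h1, Complex.normSq_apply] at h2
    linarith
  set b := traceBot u 0
  set t := traceTop u 0
  simp only [Complex.mul_im, Complex.mul_re, Complex.neg_im, Complex.neg_re, Complex.I_im,
    Complex.I_re, Complex.ofReal_re, Complex.ofReal_im, Complex.add_re, Complex.add_im,
    Complex.conj_re, Complex.conj_im, Complex.re_ofNat, Complex.im_ofNat] at E1 E2
  have F1 : t.re ^ 2 + t.im ^ 2 + b.re ^ 2 + b.im ^ 2 = 2 * (e.re * b.re + e.im * b.im) := by
    refine mul_left_cancel₀ hρ.ne' ?_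
    linarith
  have F2 : t.re * b.re + t.im * b.im = e.re * t.re + e.im * t.im := by
    refine mul_left_cancel₀ hρ.ne' ?_
    linarith
  rw [hR, hT]
  constructor
  · rw [map_mul, map_mul, ← add_mul, Complex.normSq_apply e, Complex.normSq_apply,
      Complex.normSq_apply, Complex.sub_re, Complex.sub_im]
    have : e.re * e.re + e.im * e.im = 1 := by linarith
    rw [this]
    linarith
  · have : (b - e) * e * conj (t * e) = (b - e) * conj t * (e * conj e) := by
      rw [map_mul]; ring
    have h1 : e * conj e = 1 := by
      rw [Complex.mul_conj, Complex.normSq_apply]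
      norm_cast
      linarith
    rw [this, h1, mul_one]
    simp only [Complex.mul_re, Complex.sub_re, Complex.sub_im, Complex.conj_re, Complex.conj_im]
    linarith

/-- There are no source-free fields at real `κ` and `ω` in the open first quadrant: all terms of
the imaginary part of the quadratic form have the same sign. -/
theorem eq_zero_of_im_pos {κ : ℝ} {ω : ℂ} (hre : 0 < ω.re) (him : 0 < ω.im) {u : H1per S.L}
    (hu : ∀ v, S.formH κ ω u v - ω ^ 2 * S.formB u v = 0) : u = 0 := by
  have hη : ∀ m : ℤ, 0 ≤ (S.eta m κ ω).re ∧ 0 ≤ (S.eta m κ ω).im := by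
    intro m
    refine branchSqrt_of_im_pos ?_
    have : ((S.ep0 : ℂ) * S.mu0 * ω ^ 2 - ((m : ℂ) + κ) ^ 2).im
        = S.ep0 * S.mu0 * (2 * ω.re * ω.im) := by
      have e : (S.ep0 : ℂ) * S.mu0 * ω ^ 2 - ((m : ℂ) + κ) ^ 2
          = ((S.ep0 * S.mu0 : ℝ) : ℂ) * ω ^ 2 - (((m + κ) ^ 2 : ℝ) : ℂ) := by
        push_cast
        ring
      rw [e, Complex.sub_im, Complex.ofReal_im, Complex.im_ofReal_mul, sub_zero, sq,
        Complex.mul_im]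
      ring
    rw [this]
    have := S.ep0_pos
    have := S.mu0_pos
    positivity
  set X : ℤ → ℂ := fun m => -Complex.I * S.eta m κ ω *
    (traceTop u m * conj (traceTop u m) + traceBot u m * conj (traceBot u m)) with hXdef
  have hX : ∀ m, 0 ≤ (X m).re ∧ (X m).im ≤ 0 := by
    intro m
    have hr : traceTop u m * conj (traceTop u m) + traceBot u m * conj (traceBot u m)
        = ((Complex.normSq (traceTop u m) + Complex.normSq (traceBot u m) : ℝ) : ℂ) := by
      rw [Complex.mul_conj, Complex.mul_conj]
      push_cast
      rfl
    have h0 := add_nonneg (Complex.normSq_nonneg (traceTop u m))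
      (Complex.normSq_nonneg (traceBot u m))
    simp only [hXdef, hr]
    rw [Complex.re_mul_ofReal, Complex.im_mul_ofReal]
    simp only [neg_mul, Complex.neg_re, Complex.neg_im, Complex.I_mul_re, Complex.I_mul_im, neg_neg]
    exact ⟨mul_nonneg (hη m).2 h0, neg_nonpos.2 (mul_nonneg (hη m).1 h0)⟩
  have hD : 0 ≤ (∑' m, X m).re ∧ (∑' m, X m).im ≤ 0 := by
    by_cases hs : Summable X
    · rw [Complex.re_tsum hs, Complex.im_tsum hs]
      exact ⟨tsum_nonneg fun m => (hX m).1, tsum_nonpos fun m => (hX m).2⟩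
    -- A divergent series has the value `0`, which satisfies both inequalities.
    · simp [tsum_eq_zero_of_not_summable hs]
  have h := hu u
  rw [formH_eq, dtnForm] at h
  change _ + (S.mu0 : ℂ)⁻¹ * (2 * Real.pi * ∑' m, X m) - _ = 0 at h
  set D := ∑' m, X m
  have hVr := S.volForm_self κ u
  have hBr := S.formB_self u
  set V : ℝ := ∫ p, (S.mu p)⁻¹ * (‖dx u p + Complex.I * κ * val u p‖ ^ 2
      + ‖dz u p‖ ^ 2) ∂cellMeasure S.L with hVdef
  set B : ℝ := ∫ p, S.ep p * ‖val u p‖ ^ 2 ∂cellMeasure S.L with hBdef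
  have hV0 : 0 ≤ V := integral_nonneg fun p =>
    mul_nonneg (inv_pos.2 (S.mu_pos p)).le (by positivity)
  have hB0 : 0 ≤ B := integral_nonneg fun p => mul_nonneg (S.ep_pos p).le (by positivity)
  have hc : 0 < S.mu0⁻¹ * (2 * Real.pi) := mul_pos (inv_pos.2 S.mu0_pos) (by positivity)
  have hcoef : (S.mu0 : ℂ)⁻¹ * (2 * Real.pi * D) = ((S.mu0⁻¹ * (2 * Real.pi) : ℝ) : ℂ) * D := by
    push_cast
    ring
  rw [hVr, hBr, hcoef] at h
  set k := S.mu0⁻¹ * (2 * Real.pi)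
  have hi := congrArg Complex.im h
  have hr := congrArg Complex.re h
  simp only [Complex.sub_im, Complex.add_im, Complex.sub_re, Complex.add_re, Complex.ofReal_im,
    Complex.ofReal_re, Complex.im_ofReal_mul, Complex.re_ofReal_mul, Complex.re_mul_ofReal,
    Complex.im_mul_ofReal, Complex.zero_im, Complex.zero_re] at hi hr
  have hw : (ω ^ 2).im = 2 * ω.re * ω.im := by
    simp [sq]
    ring
  have hwpos : 0 < (ω ^ 2).im := by rw [hw]; positivity
  have hBz : B = 0 := by
    have h1 : k * D.im ≤ 0 := mul_nonpos_of_nonneg_of_nonpos hc.le hD.2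
    have h2 : (ω ^ 2).im * B ≤ 0 := by linarith
    nlinarith
  have hVz : V = 0 := by
    have h1 : 0 ≤ k * D.re := mul_nonneg hc.le hD.1
    rw [hBz, mul_zero] at hr
    linarith
  exact S.eq_zero_of_forms_eq_zero (κ := κ) (by rw [hBr, hBz]; simp) (by rw [hVr, hVz]; simp)

end Slab

/-! ### Solvability of the scattering problem -/

/-- Integration against a continuous function as a bounded functional on `L²`. -/
def pairing (L : ℝ) {g : ℝ × ℝ → ℂ} (hg : Continuous g) : Lp ℂ 2 (cellMeasure L) →L[ℂ] ℂ :=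
  innerSL ℂ (toL2 L (Complex.continuous_conj.comp hg))

theorem pairing_apply {L : ℝ} {g : ℝ × ℝ → ℂ} (hg : Continuous g) (w : Lp ℂ 2 (cellMeasure L)) :
    pairing L hg w = ∫ p, w p * g p ∂cellMeasure L := by
  rw [pairing, innerSL_apply_apply, inner_toL2]
  simp

theorem isClosed_H1per (L : ℝ) : IsClosed (H1per L : Set (L2Triple L)) := by
  have e : (H1per L : Set (L2Triple L)) = ⋂ f : {f : ℝ × ℝ → ℂ // IsTest L f},
      {U | pairing L (f.2.continuous_fderiv_apply (1, 0)) (U 0)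
          = -pairing L f.2.smooth.continuous (U 1) ∧
        pairing L (f.2.continuous_fderiv_apply (0, 1)) (U 0)
          = -pairing L f.2.smooth.continuous (U 2)} := by
    ext U
    simp only [Set.mem_iInter, Set.mem_ofPred_eq, pairing_apply, Subtype.forall]
    rfl
  rw [e]
  have hc : ∀ i : Fin 3, Continuous fun U : L2Triple L => U i := fun i =>
    (PiLp.proj (𝕜 := ℂ) 2 (fun _ : Fin 3 => Lp ℂ 2 (cellMeasure L)) i).continuous
  refine isClosed_iInter fun f => ?_
  exact (isClosed_eq ((pairing L _).continuous.comp (hc 0))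
    ((pairing L _).continuous.comp (hc 1)).neg).inter
    (isClosed_eq ((pairing L _).continuous.comp (hc 0))
    ((pairing L _).continuous.comp (hc 2)).neg)

/-- Completeness gives access to the Riesz representation theorem on `H¹`. -/
instance completeSpace_H1per (L : ℝ) : CompleteSpace (H1per L) :=
  (isClosed_H1per L).completeSpace_coe

/-- The Fourier coefficients of the trace on `z = -L` are bounded functionals on `H¹`. -/
theorem exists_inner_eq_traceBot (L : ℝ) (m : ℤ) :
    ∃ y : H1per L, ∀ v : H1per L, ⟪v, y⟫_ℂ = conj (traceBot v m) := by
  have hm := continuous_harmonic m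
  have h1 : Continuous fun p : ℝ × ℝ => (((L - p.2) / (2 * L) : ℝ) : ℂ) * harmonic m p := by
    fun_prop
  have h2 : Continuous fun p : ℝ × ℝ => ((-1 / (2 * L) : ℝ) : ℂ) * harmonic m p := by
    fun_prop
  let pr : Fin 3 → L2Triple L →L[ℂ] Lp ℂ 2 (cellMeasure L) := fun i =>
    PiLp.proj (𝕜 := ℂ) 2 (fun _ : Fin 3 => Lp ℂ 2 (cellMeasure L)) i
  let φ : H1per L →L[ℂ] ℂ := (-(2 * Real.pi : ℂ)⁻¹) •
    (((pairing L h1).comp (pr 2) + (pairing L h2).comp (pr 0)).comp (H1per L).subtypeL)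
  refine ⟨(InnerProductSpace.toDual ℂ (H1per L)).symm φ, fun v => ?_⟩
  rw [← inner_conj_symm (𝕜 := ℂ) v, InnerProductSpace.toDual_symm_apply, traceBot_eq]
  change conj (-(2 * Real.pi : ℂ)⁻¹ * (pairing L h1 (v.1 2) + pairing L h2 (v.1 0))) = _
  rw [pairing_apply, pairing_apply, neg_mul]
  rfl

namespace Slab

variable (S : Slab)

theorem represents_formOp {c : H1per S.L → H1per S.L → ℂ} (h : S.formOp c ≠ 0) :
    S.Represents c (S.formOp c) := by
  unfold formOp at h ⊢
  split_ifs at h ⊢ with hc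
  · exact hc.choose_spec
  · exact absurd rfl h

/-- If `A(κ, ω)` is not the identity, then the forms are represented by bounded operators and
`C₁` is invertible. -/
theorem represents_of_opA_ne_one {κ ω : ℂ} (h : S.opA κ ω ≠ 1) :
    IsUnit (S.formOp (S.formC1 κ ω)) ∧
      ∀ u v, ⟪v, (S.formOp (S.formC1 κ ω) + S.formOp (S.formC2 ω)) u⟫_ℂ
        = S.formH κ ω u v - ω ^ 2 * S.formB u v := by
  have hunit : IsUnit (S.formOp (S.formC1 κ ω)) := by
    by_contra hn
    exact h (by rw [opA, Ring.inverse_non_unit _ hn, zero_mul, add_zero])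
  have h1 : S.formOp (S.formC1 κ ω) ≠ 0 := fun h0 =>
    h (by rw [opA, h0, Ring.inverse_zero, zero_mul, add_zero])
  have h2 : S.formOp (S.formC2 ω) ≠ 0 := fun h0 => h (by rw [opA, h0, mul_zero, add_zero])
  refine ⟨hunit, fun u v => ?_⟩
  rw [add_apply, inner_add_right, S.represents_formOp h1 u v,
    S.represents_formOp h2 u v, formC1, formC2]
  ring

theorem formOp_mul_opA {κ ω : ℂ} (h : IsUnit (S.formOp (S.formC1 κ ω))) :
    S.formOp (S.formC1 κ ω) * S.opA κ ω
      = S.formOp (S.formC1 κ ω) + S.formOp (S.formC2 ω) := by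
  rw [opA, mul_add, mul_one, ← mul_assoc, Ring.mul_inverse_cancel _ h, one_mul]

theorem opA_ne_one {κ ω l : ℂ}
    (h : Module.End.HasEigenvalue (S.opA κ ω : Module.End ℂ (H1per S.L)) l) (hl : l ≠ 1) :
    S.opA κ ω ≠ 1 := by
  intro h1
  obtain ⟨x, hx⟩ := h.exists_hasEigenvector
  have e := hx.apply_eq_smul
  rw [h1] at e
  have e' : x = l • x := e
  have : (1 - l) • x = 0 := by rw [sub_smul, one_smul, ← e', sub_self]
  rcases smul_eq_zero.1 this with h | h
  · exact hl (sub_eq_zero.1 h).symm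
  · exact hx.2 h

/-- A zero eigenvalue of `A(κ, ω)` provides a source-free field. -/
theorem exists_sourceless {κ ω : ℂ}
    (h : Module.End.HasEigenvalue (S.opA κ ω : Module.End ℂ (H1per S.L)) 0) :
    ∃ u : H1per S.L, u ≠ 0 ∧ ∀ v, S.formH κ ω u v - ω ^ 2 * S.formB u v = 0 := by
  obtain ⟨hu, hrep⟩ := S.represents_of_opA_ne_one (S.opA_ne_one h zero_ne_one)
  obtain ⟨x, hx⟩ := h.exists_hasEigenvector
  have e : S.opA κ ω x = 0 := by
    have := hx.apply_eq_smul
    rw [zero_smul] at this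
    exact this
  refine ⟨x, hx.2, fun v => ?_⟩
  rw [← hrep, ← S.formOp_mul_opA hu, mul_apply_eq_comp, e, map_zero, inner_zero_right]

/-- The scattering problem is solvable wherever `A(κ, ω)` is invertible. -/
theorem isScattering_scattered {κ ω : ℂ} (h1 : S.opA κ ω ≠ 1) (h : IsUnit (S.opA κ ω)) :
    S.IsScattering 1 0 κ ω (S.scattered κ ω) := by
  obtain ⟨hu, hrep⟩ := S.represents_of_opA_ne_one h1
  refine Classical.epsilon_spec (p := S.IsScattering 1 0 κ ω) ?_
  have hunit := hu.mul h
  rw [S.formOp_mul_opA hu] at hunit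
  obtain ⟨y, hy⟩ := exists_inner_eq_traceBot S.L 0
  obtain ⟨V, hV⟩ := hunit
  set c : ℂ := (S.mu0 : ℂ)⁻¹ * (2 * Real.pi * (-2 * Complex.I * S.eta 0 κ ω
      * Complex.exp (-(Complex.I * S.eta 0 κ ω * S.L)))) with hc
  refine ⟨(↑V⁻¹ : H1per S.L →L[ℂ] H1per S.L) (c • y), fun v => ?_⟩
  rw [← hrep, ← hV, ← mul_apply_eq_comp, V.mul_inv, one_apply_eq_self,
    inner_smul_right (𝕜 := ℂ) v y c, hy, sourceP_left, hc]
  ring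

/-- At real pairs where the eigenvalue is small, the relations between the scattering
coefficients hold for `a = ℓ R` and `b = ℓ T`; at a zero of `ℓ` they are trivial. -/
theorem coeff_relations {κ ω δ : ℝ} (h𝒟 : (κ, ω) ∈ S.diamond) (hδ : 0 < δ) {l : ℂ}
    (hspec : spectrum ℂ (S.opA κ ω) ∩ Metric.ball 0 δ = {l})
    (heig : Module.End.HasEigenvalue (S.opA κ ω : Module.End ℂ (H1per S.L)) l) (hl : l ≠ 1)
    {ell : ℂ × ℂ → ℂ} (hell : ell (κ, ω) = 0 ∨ l ≠ 0) :
    Complex.normSq (S.coeffA ell (κ, ω)) + Complex.normSq (S.coeffB ell (κ, ω))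
        = Complex.normSq (ell (κ, ω)) ∧
      (S.coeffA ell (κ, ω) * conj (S.coeffB ell (κ, ω))).re = 0 := by
  unfold coeffA coeffB
  rcases hell with h0 | h0
  · simp [h0]
  · have hunit : IsUnit (S.opA κ ω) := by
      by_contra hn
      have : (0 : ℂ) ∈ spectrum ℂ (S.opA κ ω) ∩ Metric.ball 0 δ :=
        ⟨spectrum.zero_mem_iff ℂ |>.2 hn, Metric.mem_ball_self hδ⟩
      rw [hspec] at this
      exact h0 (Set.mem_singleton_iff.1 this).symm
    obtain ⟨h1, h2⟩ := S.scattering_relations h𝒟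
      (S.isScattering_scattered (S.opA_ne_one heig hl) hunit)
      (R := S.reflection κ ω) (T := S.transmission κ ω) rfl rfl
    constructor
    · rw [map_mul, map_mul, ← mul_add, h1, mul_one]
    · have : ell (κ, ω) * S.reflection κ ω * conj (ell (κ, ω) * S.transmission κ ω)
          = (Complex.normSq (ell (κ, ω)) : ℝ) * (S.reflection κ ω * conj (S.transmission κ ω)) := by
        rw [map_mul, ← Complex.mul_conj]
        ring
      rw [this, Complex.re_ofReal_mul, h2, mul_zero]

end Slab

/-! ### From the eigenvalue to the factorized expansions -/

theorem hasDerivAt_factored {κ₀ ω₀ : ℂ} {G : ℂ × ℂ → ℂ} (hG : AnalyticAt ℂ G (κ₀, ω₀)) :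
    HasDerivAt (fun ω : ℂ => (ω - ω₀) * G (κ₀, ω)) (G (κ₀, ω₀)) ω₀ := by
  have h1 : DifferentiableAt ℂ (fun ω : ℂ => G (κ₀, ω)) ω₀ :=
    hG.differentiableAt.comp ω₀ (by fun_prop)
  exact (((hasDerivAt_id ω₀).sub_const ω₀).mul h1.hasDerivAt).congr_deriv (by simp)

/-- A nonzero derivative in `ω` makes the analytic factor nonzero. -/
theorem Factors.ne_zero {F : ℂ × ℂ → ℂ} {κ₀ ω₀ : ℝ} {f : ℂ → ℂ} {G : ℂ × ℂ → ℂ}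
    (h : Factors F (κ₀, ω₀) f G) (hd : deriv (fun ω : ℂ => F ((κ₀ : ℂ), ω)) (ω₀ : ℂ) ≠ 0) :
    G ((κ₀ : ℂ), (ω₀ : ℂ)) ≠ 0 := by
  obtain ⟨-, f0, hG, heq⟩ := h
  have ht : Tendsto (fun ω : ℂ => ((κ₀ : ℂ), ω)) (𝓝 (ω₀ : ℂ)) (𝓝 ((κ₀ : ℂ), (ω₀ : ℂ))) :=
    tendsto_const_nhds.prodMk_nhds tendsto_id
  have he : (fun ω : ℂ => F ((κ₀ : ℂ), ω)) =ᶠ[𝓝 (ω₀ : ℂ)]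
      fun ω => (ω - ω₀) * G ((κ₀ : ℂ), ω) := by
    filter_upwards [ht.eventually heq] with ω hω
    simp [hω, f0]
  rwa [he.deriv_eq, (hasDerivAt_factored hG).deriv] at hd

theorem FactorsReal.ne_zero {F : ℝ × ℝ → ℂ} {κ₀ ω₀ : ℝ} {f : ℂ → ℂ} {G : ℂ × ℂ → ℂ}
    (h : FactorsReal F (κ₀, ω₀) f G) (hd : deriv (fun ω : ℝ => F (κ₀, ω)) ω₀ ≠ 0) :
    G ((κ₀ : ℂ), (ω₀ : ℂ)) ≠ 0 := by
  obtain ⟨-, f0, hG, heq⟩ := h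
  have ht : Tendsto (fun ω : ℝ => (κ₀, ω)) (𝓝 ω₀) (𝓝 (κ₀, ω₀)) :=
    tendsto_const_nhds.prodMk_nhds tendsto_id
  have he : (fun ω : ℝ => F (κ₀, ω)) =ᶠ[𝓝 ω₀]
      fun ω : ℝ => ((ω : ℂ) - ω₀) * G ((κ₀ : ℂ), (ω : ℂ)) := by
    filter_upwards [ht.eventually heq] with ω hω
    simp [hω, f0]
  rwa [he.deriv_eq, (hasDerivAt_factored hG).comp_ofReal.deriv] at hd

theorem analyticAt_translate {κ₀ ω₀ : ℂ} {G : ℂ × ℂ → ℂ} (hG : AnalyticAt ℂ G (κ₀, ω₀)) :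
    AnalyticAt ℂ (fun q : ℂ × ℂ => G (κ₀ + q.1, ω₀ + q.2)) (0, 0) := by
  have h1 : AnalyticAt ℂ (fun q : ℂ × ℂ => (κ₀ + q.1, ω₀ + q.2)) (0, 0) :=
    (analyticAt_const.add analyticAt_fst).prod (analyticAt_const.add analyticAt_snd)
  exact AnalyticAt.fun_comp (g := G) (by simpa using hG) h1

theorem Factors.tendsto_zero {F : ℂ × ℂ → ℂ} {κ₀ ω₀ : ℝ} {f : ℂ → ℂ} {G : ℂ × ℂ → ℂ}
    (h : Factors F (κ₀, ω₀) f G) : Tendsto F (𝓝 ((κ₀ : ℂ), (ω₀ : ℂ))) (𝓝 0) := by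
  obtain ⟨hf, f0, hG, heq⟩ := h
  have hf' : ContinuousAt (fun q : ℂ × ℂ => f (q.1 - κ₀)) ((κ₀ : ℂ), (ω₀ : ℂ)) :=
    ContinuousAt.comp (g := f) (by simpa using hf.continuousAt) (by fun_prop)
  have h1 : ContinuousAt (fun q : ℂ × ℂ => (q.2 - ω₀ + f (q.1 - κ₀)) * G q)
      ((κ₀ : ℂ), (ω₀ : ℂ)) :=
    ((by fun_prop : ContinuousAt (fun q : ℂ × ℂ => q.2 - (ω₀ : ℂ)) _).add hf').mul
      hG.continuousAt
  have h2 := h1.tendsto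
  simp only [sub_self, f0, add_zero, zero_mul] at h2
  refine h2.congr' ?_
  filter_upwards [heq] with q hq
  exact hq.symm

namespace Slab

variable (S : Slab)

/-- Stability: the zeros `ω = ω₀ - f(κ - κ₀)` of `ℓ` at real `κ` do not lie in the upper
half-plane. -/
theorem zeros_im_nonpos {κ₀ ω₀ : ℝ} (h𝒟 : (κ₀, ω₀) ∈ S.diamond) {lam : ℂ × ℂ → ℂ}
    (hlam : S.IsSimpleEigenvalueNear lam (κ₀, ω₀)) {c : ℂ} (hc : c ≠ 0) {ell : ℂ × ℂ → ℂ}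
    (hell : ∀ q, ell q = c * lam q) {f : ℂ → ℂ} {G : ℂ × ℂ → ℂ}
    (hℓ : Factors ell (κ₀, ω₀) f G) : ∀ᶠ x : ℝ in 𝓝 0, 0 ≤ (f x).im := by
  obtain ⟨hf, f0, -, heq⟩ := hℓ
  obtain ⟨δ, -, hspec⟩ := hlam
  have hf' := tendsto_real hf f0
  have hω : Tendsto (fun x : ℝ => (ω₀ : ℂ) - f x) (𝓝 0) (𝓝 (ω₀ : ℂ)) := by
    simpa using hf'.const_sub (ω₀ : ℂ)
  have hq : Tendsto (fun x : ℝ => ((κ₀ : ℂ) + x, (ω₀ : ℂ) - f x)) (𝓝 0)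
      (𝓝 ((κ₀ : ℂ), (ω₀ : ℂ))) := by
    refine Tendsto.prodMk_nhds ?_ hω
    simpa using tendsto_ofReal_zero.const_add (κ₀ : ℂ)
  have hre : ∀ᶠ x : ℝ in 𝓝 0, 0 < ((ω₀ : ℂ) - f x).re :=
    ((Complex.continuous_re.tendsto _).comp hω).eventually
      (lt_mem_nhds (by simpa using S.omega_pos_of_mem_diamond h𝒟))
  filter_upwards [hq.eventually heq, hq.eventually hspec, hre] with x h1 h2 h3
  have hl : lam ((κ₀ : ℂ) + x, (ω₀ : ℂ) - f x) = 0 := by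
    have : c * lam ((κ₀ : ℂ) + x, (ω₀ : ℂ) - f x) = 0 := by
      rw [← hell, h1]
      simp
    exact (mul_eq_zero.1 this).resolve_left hc
  by_contra! him
  have heig := h2.2.1
  rw [hl] at heig
  obtain ⟨u, hu0, hu⟩ := S.exists_sourceless heig
  refine hu0 (S.eq_zero_of_im_pos (κ := κ₀ + x) h3 (by simpa using him) ?_)
  simpa using hu

end Slab

end PeriodicSlab

end

theorem lemma3p2 (S : PeriodicSlab.Slab) (κ₀ ω₀ : ℝ) (h𝒟 : (κ₀, ω₀) ∈ S.diamond)
    (lam : ℂ × ℂ → ℂ) (hlam : S.IsSimpleEigenvalueNear lam (κ₀, ω₀))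
    (c : ℂ) (hc : c ≠ 0) (ell : ℂ × ℂ → ℂ) (hell : ∀ q, ell q = c * lam q)
    (hzero : ell ((κ₀ : ℂ), (ω₀ : ℂ)) = 0)
    (hℓω : deriv (fun ω : ℂ => ell ((κ₀ : ℂ), ω)) (ω₀ : ℂ) ≠ 0)
    (haω : deriv (fun ω : ℝ => S.coeffA ell (κ₀, ω)) ω₀ ≠ 0)
    (hbω : deriv (fun ω : ℝ => S.coeffB ell (κ₀, ω)) ω₀ ≠ 0)
    (fa fb fℓ : ℂ → ℂ) (Ga Gb Gℓ : ℂ × ℂ → ℂ)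
    (ha : PeriodicSlab.FactorsReal (S.coeffA ell) (κ₀, ω₀) fa Ga)
    (hb : PeriodicSlab.FactorsReal (S.coeffB ell) (κ₀, ω₀) fb Gb)
    (hℓ : PeriodicSlab.Factors ell (κ₀, ω₀) fℓ Gℓ)
    (r₂ t₂ ℓ₂ : ℂ) (hr₂ : r₂ = PeriodicSlab.taylorCoeff fa 2)
    (ht₂ : t₂ = PeriodicSlab.taylorCoeff fb 2) (hℓ₂ : ℓ₂ = PeriodicSlab.taylorCoeff fℓ 2)
    (him : 0 < ℓ₂.im) :
    Xor (r₂.im = 0 ∧ t₂.im = 0 ∧ r₂ ≠ t₂)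
      (r₂ = t₂ ∧ r₂.im ≠ 0 ∧ (ℓ₂ = r₂ ∨ ℓ₂ = conj r₂)) := by
  subst hr₂ ht₂ hℓ₂
  have hlim : Tendsto lam (𝓝 ((κ₀ : ℂ), (ω₀ : ℂ))) (𝓝 0) := by
    have h := hℓ.tendsto_zero.const_mul c⁻¹
    rw [mul_zero] at h
    refine h.congr fun q => ?_
    rw [hell, inv_mul_cancel_left₀ hc]
  have hcast : Tendsto (fun q : ℝ × ℝ => ((q.1 : ℂ), (q.2 : ℂ))) (𝓝 (κ₀, ω₀))
      (𝓝 ((κ₀ : ℂ), (ω₀ : ℂ))) :=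
    (by fun_prop : Continuous fun q : ℝ × ℝ => ((q.1 : ℂ), (q.2 : ℂ))).tendsto (κ₀, ω₀)
  have htrans : Tendsto (fun q : ℝ × ℝ => (κ₀ + q.1, ω₀ + q.2)) (𝓝 (0, 0)) (𝓝 (κ₀, ω₀)) := by
    have := (by fun_prop : Continuous fun q : ℝ × ℝ => (κ₀ + q.1, ω₀ + q.2)).tendsto (0, 0)
    simpa using this
  obtain ⟨δ, hδ, hspec⟩ := id hlam
  have hrel : ∀ᶠ q : ℝ × ℝ in 𝓝 (κ₀, ω₀),
      Complex.normSq (S.coeffA ell q) + Complex.normSq (S.coeffB ell q)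
          = Complex.normSq (ell (q.1, q.2)) ∧
        (S.coeffA ell q * conj (S.coeffB ell q)).re = 0 := by
    filter_upwards [S.isOpen_diamond.mem_nhds h𝒟, hcast.eventually hspec,
      hcast.eventually (hlim.eventually_ne zero_ne_one)] with q h1 h2 h3
    refine S.coeff_relations h1 hδ h2.1 h2.2.1 h3 ?_
    rw [hell]
    rcases eq_or_ne (lam ((q.1 : ℂ), (q.2 : ℂ))) 0 with h | h
    · exact Or.inl (by rw [h, mul_zero])
    · exact Or.inr h
  have hrel' : ∀ᶠ q : ℝ × ℝ in 𝓝 (0, 0),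
      Complex.normSq (PeriodicSlab.slice fa (fun q => Ga (κ₀ + q.1, ω₀ + q.2)) q.1 q.2)
        + Complex.normSq (PeriodicSlab.slice fb (fun q => Gb (κ₀ + q.1, ω₀ + q.2)) q.1 q.2)
        = Complex.normSq (PeriodicSlab.slice fℓ (fun q => Gℓ (κ₀ + q.1, ω₀ + q.2)) q.1 q.2) ∧
      (PeriodicSlab.slice fa (fun q => Ga (κ₀ + q.1, ω₀ + q.2)) q.1 q.2
        * conj (PeriodicSlab.slice fb (fun q => Gb (κ₀ + q.1, ω₀ + q.2)) q.1 q.2)).re = 0 := by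
    filter_upwards [htrans.eventually hrel, htrans.eventually ha.2.2.2,
      htrans.eventually hb.2.2.2, (hcast.comp htrans).eventually hℓ.2.2.2] with q h1 h2 h3 h4
    simp only [Function.comp, Complex.ofReal_add, add_sub_cancel_left] at h1 h2 h3 h4
    rw [h2, h3, h4] at h1
    exact h1
  rcases PeriodicSlab.taylorCoeff_dichotomy ha.1 hb.1 hℓ.1 ha.2.1 hb.2.1 hℓ.2.1
    (PeriodicSlab.analyticAt_translate ha.2.2.1) (PeriodicSlab.analyticAt_translate hb.2.2.1)
    (PeriodicSlab.analyticAt_translate hℓ.2.2.1) (by simpa using ha.ne_zero haω)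
    (by simpa using hb.ne_zero hbω) (by simpa using hℓ.ne_zero hℓω)
    (hrel'.mono fun q h => h.1) (hrel'.mono fun q h => h.2)
    (S.zeros_im_nonpos h𝒟 hlam hc hell hℓ) him with h | h
  · exact Or.inl ⟨h, fun h' => h'.2.1 h.1⟩
  · exact Or.inr ⟨h, fun h' => h.2.1 h'.1⟩
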